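/- Let $G$ be a simple graph with vertices $1,\dots,n$, $n\ge 4$, and let $\Gamma$ be a generic shortest-path triangulation of the unit sphere $S^2$ with underlying graph $G$. That is, $\Gamma$ is an embedding of $G$ on $S^2$ in which every edge is a great-circular arc of length less than $\pi$ and every face is bounded by a cycle of three edges; no great circle contains more than two vertices; and no great circle through the poles $(0,0,\pm1)$ contains more than one vertex. Faces are written as triples $(i,j,k)$ of their vertices in counterclockwise order around the interior of the face. The north (south) face is the face containing the north (south) pole in its interior; we assume that these two faces are different. All other faces are called non-polar. A longitude is an open great semicircle joining the two poles. Call $\Gamma$ *sinkable* if there is a continuous family of embeddings $\Gamma_t$, $t\in[0,1]$, of $G$, with all edges shortest paths, such that $\Gamma_0=\Gamma$, every vertex stays on its longitude for all $t$, and $\Gamma_1$ is a generic shortest-path triangulation all of whose vertices lie strictly below the equator ($z<0$). Let $(x_i,y_i,z_i)$ be any positive multiple of the position vector of vertex $i$, for each $i$. Then $\Gamma$ is sinkable if and only if the following linear program in the variables $z'_1,\dots,z'_n$ is feasible: $$\begin{array}{rll} \text{maximize} & \sum_i z'_i\\ \text{subject to} & z'_i=-1 & \text{for every vertex } i \text{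 of the north face},\\ & \mathrm{vol}'(i,j,k)\ge 0 & \text{for every non-polar face } (i,j,k), \end{array}$$ where $$\mathrm{vol}'(i,j,k)=\det\begin{pmatrix}x_i&y_i&z'_i\\x_j&y_j&z'_j\\x_k&y_k&z'_k\end{pmatrix}.$$ -/

import Mathlib

noncomputable section

namespace Sinking

/-- Euclidean three-space. -/
abbrev E3 : Type := EuclideanSpace ℝ (Fin 3)

/-- The unit sphere `x² + y² + z² = 1`. -/
abbrev S2 : Type := Metric.sphere (0 : E3) 1

/-- The point `(0, 0, 1)`. -/
def northPole : S2 :=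
  ⟨!₂[0, 0, 1], by simp [EuclideanSpace.norm_eq, Fin.sum_univ_three]⟩

/-- The point `(0, 0, -1)`. -/
def southPole : S2 :=
  ⟨!₂[0, 0, -1], by simp [EuclideanSpace.norm_eq, Fin.sum_univ_three]⟩

/-- The great circle with normal vector `ν` (which is required to be nonzero wherever this is
used). -/
def greatCircle (ν : E3) : Set S2 := {w | inner ℝ ν (w : E3) = 0}

/-- The longitude at angle `θ`: the open great semicircle from pole to pole through
`(cos θ, sin θ, 0)`. The poles themselves are on no longitude. -/
def longitude (θ : ℝ) : Set S2 :=
  {w | ∃ r : ℝ, 0 < r ∧ (w : E3) 0 = r * Real.cos θ ∧ (w : E3) 1 = r * Real.sin θ}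

/-- Two points lie on a common longitude. -/
def SameLongitude (u v : S2) : Prop := ∃ θ : ℝ, u ∈ longitude θ ∧ v ∈ longitude θ

/-- The shortest path on the sphere between two points that are not antipodal. -/
def arc (u v : S2) : Set S2 :=
  {w | ∃ a b : ℝ, 0 ≤ a ∧ 0 ≤ b ∧ (w : E3) = a • (u : E3) + b • (v : E3)}

/-- The determinant of the matrix with rows `u`, `v`, `w`. -/
def det3 (u v w : E3) : ℝ :=
  Matrix.det !![u 0, u 1, u 2; v 0, v 1, v 2; w 0, w 1, w 2]

/-- The open spherical triangle spanned by three linearly independent points. -/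
def openTriangle (u v w : S2) : Set S2 :=
  {s | ∃ a b c : ℝ, 0 < a ∧ 0 < b ∧ 0 < c ∧
    (s : E3) = a • (u : E3) + b • (v : E3) + c • (w : E3)}

/-- The closed spherical triangle spanned by three linearly independent points. -/
def closedTriangle (u v w : S2) : Set S2 :=
  {s | ∃ a b c : ℝ, 0 ≤ a ∧ 0 ≤ b ∧ 0 ≤ c ∧
    (s : E3) = a • (u : E3) + b • (v : E3) + c • (w : E3)}

/-- The side of the geodesic triangle `u → v → w → u` around which this cycle runs
counterclockwise (seen from outside the sphere), that is, the side to the left of the cycle. It is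
the small triangle if `(u, v, w)` is positively oriented, and the complement of the small triangle
(a region of area greater than `2π`) if `(u, v, w)` is negatively oriented. -/
def ccwRegion (u v w : S2) : Set S2 :=
  {s | (0 < det3 u v w ∧ s ∈ openTriangle u v w) ∨
    (det3 u v w < 0 ∧ s ∉ closedTriangle u v w)}

section Drawings

variable {n : ℕ}

/-- The map `p` of the vertices to the sphere, with every edge drawn as the shortest path between
its endpoints, is an embedding of `G`: vertices are distinct points, edges have length less than
`π`, and edges meet vertices and other edges only at common endpoints. -/
structure IsShortestPathEmbedding (G : SimpleGraph (Fin n)) (p : Fin n → S2) : Prop where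
  injective : Function.Injective p
  length_lt : ∀ i j, G.Adj i j → InnerProductGeometry.angle (p i : E3) (p j : E3) < Real.pi
  vertex_edge : ∀ i j k, G.Adj i j → p k ∈ arc (p i) (p j) → k = i ∨ k = j
  edge_edge : ∀ i j k l, G.Adj i j → G.Adj k l → s(i, j) ≠ s(k, l) →
    ∀ w, w ∈ arc (p i) (p j) → w ∈ arc (p k) (p l) →
      ∃ m, (m = i ∨ m = j) ∧ (m = k ∨ m = l) ∧ w = p m

/-- The set of points of the sphere covered by the vertices and edges of the drawing. -/
def drawing (G : SimpleGraph (Fin n)) (p : Fin n → S2) : Set S2 :=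
  {w | (∃ i, w = p i) ∨ ∃ i j, G.Adj i j ∧ w ∈ arc (p i) (p j)}

/-- The faces of a drawing: the connected components of the complement of the drawing. -/
def IsFaceSet (G : SimpleGraph (Fin n)) (p : Fin n → S2) (F : Set S2) : Prop :=
  ∃ x, x ∉ drawing G p ∧ F = connectedComponentIn (drawing G p)ᶜ x

/-- The three vertices `i, j, k` are mutually adjacent and bound a face, around whose interior they
appear in counterclockwise order. (For vertices on no common great circle.) -/
def IsFace (G : SimpleGraph (Fin n)) (p : Fin n → S2) (i j k : Fin n) : Prop :=
  G.Adj i j ∧ G.Adj j k ∧ G.Adj k i ∧ IsFaceSet G p (ccwRegion (p i) (p j) (p k))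

/-- `p` is a generic shortest-path triangulation with underlying graph `G`: an embedding with
shortest-path edges, with at most two vertices on any great circle and at most one vertex on any
great circle through the poles, such that every face is bounded by a cycle of three edges. -/
structure IsGenericTriangulation (G : SimpleGraph (Fin n)) (p : Fin n → S2) : Prop where
  embedding : IsShortestPathEmbedding G p
  generic : ∀ ν : E3, ν ≠ 0 → {i | p i ∈ greatCircle ν}.ncard ≤ 2
  generic_pole : ∀ ν : E3, ν ≠ 0 → northPole ∈ greatCircle ν → southPole ∈ greatCircle ν →
    {i | p i ∈ greatCircle ν}.ncard ≤ 1
  triangular : ∀ F, IsFaceSet G p F → ∃ i j k, G.Adj i j ∧ G.Adj j k ∧ G.Adj k i ∧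
    F = ccwRegion (p i) (p j) (p k)

/-- `(i, j, k)` is the north face: its interior contains the north pole. -/
def IsNorthFace (G : SimpleGraph (Fin n)) (p : Fin n → S2) (i j k : Fin n) : Prop :=
  IsFace G p i j k ∧ northPole ∈ ccwRegion (p i) (p j) (p k)

/-- `(i, j, k)` is the south face: its interior contains the south pole. -/
def IsSouthFace (G : SimpleGraph (Fin n)) (p : Fin n → S2) (i j k : Fin n) : Prop :=
  IsFace G p i j k ∧ southPole ∈ ccwRegion (p i) (p j) (p k)

/-- `(i, j, k)` is a face that is neither the north face nor the south face. -/
def IsNonPolarFace (G : SimpleGraph (Fin n)) (p : Fin n → S2) (i j k : Fin n) : Prop :=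
  IsFace G p i j k ∧ ¬ IsNorthFace G p i j k ∧ ¬ IsSouthFace G p i j k

/-- `H` is a longitudinal morph from `p` to `q`: a continuous family of shortest-path embeddings
in which every vertex stays on its longitude. (The shortest-path edges are determined by their
endpoints and vary continuously with them.) -/
structure IsLongitudinalMorph (G : SimpleGraph (Fin n)) (p q : Fin n → S2)
    (H : unitInterval → Fin n → S2) : Prop where
  continuous : ∀ i, Continuous fun t => H t i
  source : H 0 = p
  target : H 1 = q
  embedding : ∀ t, IsShortestPathEmbedding G (H t)
  longitudinal : ∀ t i, SameLongitude (p i) (H t i)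

/-- A triangulation is southern if every vertex lies below the equator. -/
def IsSouthern (p : Fin n → S2) : Prop := ∀ i, (p i : E3) 2 < 0

/-- A triangulation is sinkable if there is a longitudinal morph from it to a southern
triangulation. -/
def Sinkable (G : SimpleGraph (Fin n)) (p : Fin n → S2) : Prop :=
  ∃ q : Fin n → S2, IsGenericTriangulation G q ∧ IsSouthern q ∧
    ∃ H : unitInterval → Fin n → S2, IsLongitudinalMorph G p q H

/-- `X` is a choice of signed homogeneous coordinate vectors for the vertices: every `X i` is a
positive multiple of the point `p i`. -/
def IsHomogeneousCoordinates (p : Fin n → S2) (X : Fin n → E3) : Prop :=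
  ∀ i, ∃ r : ℝ, 0 < r ∧ X i = r • (p i : E3)

/-- A linear program (maximization) in real variables `z i`, with finitely many constraints
`ℓ z = b` and finitely many constraints `ℓ z ≥ b`. -/
structure LinearProgram (n : ℕ) where
  objective : (Fin n → ℝ) →ₗ[ℝ] ℝ
  eqs : Set (((Fin n → ℝ) →ₗ[ℝ] ℝ) × ℝ)
  eqs_finite : eqs.Finite
  ges : Set (((Fin n → ℝ) →ₗ[ℝ] ℝ) × ℝ)
  ges_finite : ges.Finite

/-- A linear program is feasible if some vector satisfies all of its constraints. -/
def LinearProgram.Feasible (L : LinearProgram n) : Prop :=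
  ∃ z : Fin n → ℝ, (∀ c ∈ L.eqs, c.1 z = c.2) ∧ ∀ c ∈ L.ges, c.2 ≤ c.1 z

/-- The determinant with rows `(x_i, y_i, z'_i)`, `(x_j, y_j, z'_j)`, `(x_k, y_k, z'_k)`, as a
linear function of the vector `z'`, where `x` and `y` are the first two coordinates of `X`. -/
def vol' (X : Fin n → E3) (i j k : Fin n) : (Fin n → ℝ) →ₗ[ℝ] ℝ where
  toFun z := Matrix.det !![X i 0, X i 1, z i; X j 0, X j 1, z j; X k 0, X k 1, z k]
  map_add' z w := by simp [Matrix.det_fin_three]; ring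
  map_smul' a z := by simp [Matrix.det_fin_three]; ring

/-- The linear program: maximize `∑ i, z' i` subject to `z' i = -1` for every vertex `i` of the
north face and `vol' i j k ≥ 0` for every non-polar face `(i, j, k)`. -/
def sinkLP (G : SimpleGraph (Fin n)) (p : Fin n → S2) (X : Fin n → E3) : LinearProgram n where
  objective := ∑ i, LinearMap.proj i
  eqs := (fun i => (LinearMap.proj i, -1)) '' {i | ∃ j k, IsNorthFace G p i j k}
  eqs_finite := Set.toFinite _
  ges := (fun f : Fin n × Fin n × Fin n => (vol' X f.1 f.2.1 f.2.2, 0)) ''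
    {f | IsNonPolarFace G p f.1 f.2.1 f.2.2}
  ges_finite := Set.toFinite _

end Drawings

end Sinking

end

/-!
Moving the vertices along their longitudes amounts, up to rescaling, to adding multiples of the
polar axis to their position vectors. As long as every non-polar face keeps its orientation, such a
displacement acts on each non-polar face as a vertical shear, hence preserves the order of the
drawing along every vertical line; the drawing therefore stays embedded, and the region it leaves
uncovered consists of the two polar faces.

The linear program asks for a displacement under which no non-polar face is turned over. Scaling a
feasible displacement by `t < 1` keeps all non-polar faces strictly positive, and for generic `t`
close to `1` the resulting triangulation is generic and, like its north face, below the equator.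
Conversely, along a longitudinal morph no non-polar face degenerates: the three edges of a
degenerate face without a vertex on the opposite edge wind around the axis, so that the face would
have contained a pole from the start. Thus all non-polar faces remain positive, and a vertical
shear of the final position normalises the heights of the north face to `-1`.
-/

noncomputable section

namespace Sinking

/-- The unit vector pointing to the north pole. -/
def zAxis : E3 := !₂[0, 0, 1]

@[simp] lemma zAxis_zero : zAxis 0 = 0 := by simp [zAxis]

@[simp] lemma zAxis_one : zAxis 1 = 0 := by simp [zAxis]

@[simp] lemma zAxis_two : zAxis 2 = 1 := by simp [zAxis]

lemma smul_zAxis_ne_zero {r : ℝ} (hr : r ≠ 0) : r • zAxis ≠ 0 := fun h =>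
  hr (by simpa using congrArg (· 2) h)

/-- The determinant of the horizontal parts of two vectors, `det3 u v zAxis`. -/
def cross (u v : E3) : ℝ := u 0 * v 1 - u 1 * v 0

lemma ext3 {u v : E3} (h0 : u 0 = v 0) (h1 : u 1 = v 1) (h2 : u 2 = v 2) : u = v := by
  ext m; fin_cases m <;> assumption

lemma inner_eq (u v : E3) : inner ℝ u v = u 0 * v 0 + u 1 * v 1 + u 2 * v 2 := by
  simp [PiLp.inner_apply, Fin.sum_univ_three]; ring

section Determinants

variable {u v w : E3}

lemma det3_eq (u v w : E3) : det3 u v w =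
    u 0 * v 1 * w 2 - u 0 * v 2 * w 1 - u 1 * v 0 * w 2 + u 1 * v 2 * w 0 + u 2 * v 0 * w 1
      - u 2 * v 1 * w 0 := by
  simp [det3, Matrix.det_fin_three]

lemma det3_rotate (u v w : E3) : det3 u v w = det3 v w u := by simp only [det3_eq]; ring

lemma isLinearMap_det3_fst (v w : E3) : IsLinearMap ℝ fun s => det3 s v w where
  map_add s t := by simp [det3_eq]; ring
  map_smul a s := by simp [det3_eq]; ring

lemma isLinearMap_det3_snd (u w : E3) : IsLinearMap ℝ fun s => det3 u s w := by
  simpa only [det3_rotate u] using isLinearMap_det3_fst w u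

lemma isLinearMap_det3_thd (u v : E3) : IsLinearMap ℝ fun s => det3 u v s := by
  simpa only [det3_rotate _ u v] using isLinearMap_det3_fst u v

lemma det3_smul_smul_smul (u v w : E3) (a b c : ℝ) :
    det3 (a • u) (b • v) (c • w) = a * b * c * det3 u v w := by
  simp [det3_eq]; ring

lemma det3_smul_zAxis_fst (v w : E3) (h : ℝ) : det3 (h • zAxis) v w = h * cross v w := by
  simp [det3_eq, cross]; ring

lemma det3_smul_zAxis_snd (u w : E3) (h : ℝ) : det3 u (h • zAxis) w = h * cross w u := by
  simp [det3_eq, cross]; ring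

lemma det3_smul_zAxis_thd (u v : E3) (h : ℝ) : det3 u v (h • zAxis) = h * cross u v := by
  simp [det3_eq, cross]; ring

lemma det3_add_zAxis_fst (v w s : E3) (h : ℝ) :
    det3 (s + h • zAxis) v w = det3 s v w + h * cross v w := by
  rw [(isLinearMap_det3_fst v w).map_add, det3_smul_zAxis_fst]

lemma det3_add_zAxis_snd (u w s : E3) (h : ℝ) :
    det3 u (s + h • zAxis) w = det3 u s w + h * cross w u := by
  rw [(isLinearMap_det3_snd u w).map_add, det3_smul_zAxis_snd]

lemma det3_add_zAxis_thd (u v s : E3) (h : ℝ) :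
    det3 u v (s + h • zAxis) = det3 u v s + h * cross u v := by
  rw [(isLinearMap_det3_thd u v).map_add, det3_smul_zAxis_thd]

lemma det3_smul_zAxis_eq (u v w : E3) :
    det3 u v w • zAxis = cross v w • u + cross w u • v + cross u v • w := by
  apply ext3 <;> simp [det3_eq, cross] <;> ring

lemma det3_cramer (u v w s : E3) :
    det3 u v w • s = det3 s v w • u + det3 u s w • v + det3 u v s • w := by
  apply ext3 <;> simp [det3_eq] <;> ring

lemma eq_comb_iff (hD : det3 u v w ≠ 0) {s : E3} {a b c : ℝ} : s = a • u + b • v + c • w ↔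
    det3 s v w = a * det3 u v w ∧ det3 u s w = b * det3 u v w ∧
      det3 u v s = c * det3 u v w := by
  constructor
  · rintro rfl
    refine ⟨?_, ?_, ?_⟩ <;> simp [det3_eq] <;> ring
  · rintro ⟨ha, hb, hc⟩
    apply smul_right_injective E3 hD
    simp only [det3_cramer u v w s, ha, hb, hc, smul_add, smul_smul, mul_comm]

lemma exists_eq_comb (hD : det3 u v w ≠ 0) (s : E3) :
    ∃ a b c : ℝ, s = a • u + b • v + c • w :=
  ⟨_, _, _, (eq_comb_iff hD).2 ⟨(div_mul_cancel₀ _ hD).symm, (div_mul_cancel₀ _ hD).symm,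
    (div_mul_cancel₀ _ hD).symm⟩⟩

lemma rows_mulVec (u v w ν : E3) :
    (!![u 0, u 1, u 2; v 0, v 1, v 2; w 0, w 1, w 2] : Matrix (Fin 3) (Fin 3) ℝ).mulVec ν.ofLp =
      ![inner ℝ ν u, inner ℝ ν v, inner ℝ ν w] := by
  ext m
  fin_cases m <;> simp [Matrix.mulVec, dotProduct, Fin.sum_univ_three, inner_eq, mul_comm]

lemma det3_eq_zero_iff : det3 u v w = 0 ↔
    ∃ ν : E3, ν ≠ 0 ∧ inner ℝ ν u = 0 ∧ inner ℝ ν v = 0 ∧ inner ℝ ν w = 0 := by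
  rw [det3, ← Matrix.exists_mulVec_eq_zero_iff, (WithLp.equiv 2 (Fin 3 → ℝ)).symm.exists_congr_left]
  refine exists_congr fun ν => and_congr (by simp) ?_
  rw [show (WithLp.equiv 2 (Fin 3 → ℝ)).symm.symm ν = ν.ofLp from rfl, rows_mulVec]
  simp [funext_iff, Fin.forall_fin_succ]

lemma exists_inner_eq (hD : det3 u v w ≠ 0) (a b c : ℝ) :
    ∃ ν : E3, inner ℝ ν u = a ∧ inner ℝ ν v = b ∧ inner ℝ ν w = c := by
  obtain ⟨ν, hν⟩ := Matrix.mulVec_surjective_iff_isUnit.2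
    ((Matrix.isUnit_iff_isUnit_det _).2 (isUnit_iff_ne_zero.2 hD)) ![a, b, c]
  have h := rows_mulVec u v w (WithLp.toLp 2 ν)
  rw [hν] at h
  exact ⟨_, (congrFun h 0).symm, (congrFun h 1).symm, (congrFun h 2).symm⟩

lemma exists_horizontal_of_cross_eq_zero (h : cross u v = 0) :
    ∃ ν : E3, ν ≠ 0 ∧ ν 2 = 0 ∧ inner ℝ ν u = 0 ∧ inner ℝ ν v = 0 := by
  have hD : det3 u v zAxis = 0 := by simpa [det3_eq, cross] using h
  obtain ⟨ν, hν, hu, hv, hz⟩ := det3_eq_zero_iff.1 hD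
  exact ⟨ν, hν, by simpa [inner_eq] using hz, hu, hv⟩

end Determinants

section BoundaryCoordinates

/-- Coordinates of a boundary point of the cone spanned by three vectors. -/
def IsBoundaryCoord (a b c : ℝ) : Prop := (0 ≤ a ∧ 0 ≤ b ∧ 0 ≤ c) ∧ (a = 0 ∨ b = 0 ∨ c = 0)

lemma exists_isBoundaryCoord_add_mul {x y z : ℝ} (hx : 0 < x) (hy : 0 < y) (hz : 0 < z)
    (a b c : ℝ) : ∃ t : ℝ, IsBoundaryCoord (a + t * x) (b + t * y) (c + t * z) := by
  have nonneg {r q t : ℝ} (hr : 0 < r) (ht : -q / r ≤ t) : 0 ≤ q + t * r := by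
    linarith [(div_le_iff₀ hr).1 ht]
  have eq_zero {r q t : ℝ} (hr : 0 < r) (ht : t = -q / r) : q + t * r = 0 := by
    rw [ht, div_mul_cancel₀ _ hr.ne', add_neg_cancel]
  refine ⟨max (-a / x) (max (-b / y) (-c / z)),
    ⟨nonneg hx (by simp), nonneg hy (by simp), nonneg hz (by simp)⟩, ?_⟩
  rcases max_choice (-a / x) (max (-b / y) (-c / z)) with h | h
  · exact Or.inl (eq_zero hx h)
  · rcases max_choice (-b / y) (-c / z) with h' | h'
    · exact Or.inr (Or.inl (eq_zero hy (h.trans h')))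
    · exact Or.inr (Or.inr (eq_zero hz (h.trans h')))

end BoundaryCoordinates

section Cones

variable {u v w s : E3} {a b c σ : ℝ}

/-- The cone over `ccwRegion`, described by the signs of the coordinates with respect to `u`, `v`,
`w`; it is empty if these are linearly dependent. -/
def ccwCone (u v w : E3) : Set E3 :=
  {s | (0 < det3 u v w ∧ 0 < det3 s v w ∧ 0 < det3 u s w ∧ 0 < det3 u v s) ∨
    (det3 u v w < 0 ∧ (0 < det3 s v w ∨ 0 < det3 u s w ∨ 0 < det3 u v s))}

lemma ccwCone_of_pos (hD : 0 < det3 u v w) :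
    ccwCone u v w = {s | 0 < det3 s v w} ∩ ({s | 0 < det3 u s w} ∩ {s | 0 < det3 u v s}) := by
  ext s; simp [ccwCone, hD, hD.not_gt]

lemma ccwCone_of_neg (hD : det3 u v w < 0) :
    ccwCone u v w = {s | 0 < det3 s v w} ∪ ({s | 0 < det3 u s w} ∪ {s | 0 < det3 u v s}) := by
  ext s; simp [ccwCone, hD, hD.not_gt]

lemma det3_ne_zero_of_mem_ccwCone (hs : s ∈ ccwCone u v w) : det3 u v w ≠ 0 :=
  hs.elim (fun h => h.1.ne') fun h => h.1.ne

lemma comb_mem_ccwCone_iff : a • u + b • v + c • w ∈ ccwCone u v w ↔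
    (0 < det3 u v w ∧ 0 < a ∧ 0 < b ∧ 0 < c) ∨ (det3 u v w < 0 ∧ (a < 0 ∨ b < 0 ∨ c < 0)) := by
  rcases eq_or_ne (det3 u v w) 0 with hD | hD
  · simp [ccwCone, hD]
  obtain ⟨ha, hb, hc⟩ := (eq_comb_iff hD).1 (rfl : a • u + b • v + c • w = _)
  simp only [ccwCone, Set.mem_ofPred_eq, ha, hb, hc]
  exact or_congr
    (and_congr_right fun hD => by simp only [mul_pos_iff_of_pos_right hD])
    (and_congr_right fun hD => by simp [mul_pos_iff, hD, hD.not_gt])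

lemma mem_ccwRegion {u v w s : S2} : s ∈ ccwRegion u v w ↔ (s : E3) ∈ ccwCone u v w := by
  rcases eq_or_ne (det3 (u : E3) v w) 0 with hD | hD
  · simp [ccwRegion, ccwCone, hD]
  obtain ⟨a, b, c, hs⟩ := exists_eq_comb hD (s : E3)
  have coords {a' b' c' : ℝ} (hs' : (s : E3) = a' • (u : E3) + b' • (v : E3) + c' • (w : E3)) :
      a' = a ∧ b' = b ∧ c' = c := by
    obtain ⟨ha, hb, hc⟩ := (eq_comb_iff hD).1 hs
    obtain ⟨ha', hb', hc'⟩ := (eq_comb_iff hD).1 hs'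
    exact ⟨mul_right_cancel₀ hD (ha'.symm.trans ha), mul_right_cancel₀ hD (hb'.symm.trans hb),
      mul_right_cancel₀ hD (hc'.symm.trans hc)⟩
  have open_iff : s ∈ openTriangle u v w ↔ 0 < a ∧ 0 < b ∧ 0 < c := by
    refine ⟨?_, fun ⟨ha, hb, hc⟩ => ⟨a, b, c, ha, hb, hc, hs⟩⟩
    rintro ⟨a', b', c', ha, hb, hc, hs'⟩
    obtain ⟨rfl, rfl, rfl⟩ := coords hs'
    exact ⟨ha, hb, hc⟩
  have closed_iff : s ∈ closedTriangle u v w ↔ 0 ≤ a ∧ 0 ≤ b ∧ 0 ≤ c := by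
    refine ⟨?_, fun ⟨ha, hb, hc⟩ => ⟨a, b, c, ha, hb, hc, hs⟩⟩
    rintro ⟨a', b', c', ha, hb, hc, hs'⟩
    obtain ⟨rfl, rfl, rfl⟩ := coords hs'
    exact ⟨ha, hb, hc⟩
  rw [hs, comb_mem_ccwCone_iff, ccwRegion, Set.mem_ofPred_eq, open_iff, closed_iff,
    not_and_or, not_and_or, not_le, not_le, not_le]

lemma ccwCone_smul_iff {d : ℝ} (ha : 0 < a) (hb : 0 < b) (hc : 0 < c) (hd : 0 < d) :
    d • s ∈ ccwCone (a • u) (b • v) (c • w) ↔ s ∈ ccwCone u v w := by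
  have neg_iff {r x : ℝ} (hr : 0 < r) : r * x < 0 ↔ x < 0 := by
    simp [mul_neg_iff, hr, hr.not_gt]
  have habc : 0 < a * b * c := by positivity
  have hdbc : 0 < d * b * c := by positivity
  have hadc : 0 < a * d * c := by positivity
  have habd : 0 < a * b * d := by positivity
  simp only [ccwCone, Set.mem_ofPred_eq, det3_smul_smul_smul, neg_iff habc,
    mul_pos_iff_of_pos_left, habc, hdbc, hadc, habd]

lemma ccwCone_rotate (u v w : E3) : ccwCone u v w = ccwCone v w u := by
  ext s
  simp only [ccwCone, Set.mem_ofPred_eq]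
  rw [det3_rotate u v w, det3_rotate s v w, det3_rotate u s w, det3_rotate u v s]
  tauto

lemma zero_notMem_ccwCone (u v w : E3) : (0 : E3) ∉ ccwCone u v w := by
  simp [ccwCone, det3_eq]

lemma ne_zero_of_mem_ccwCone (hs : s ∈ ccwCone u v w) : s ≠ 0 := fun h =>
  zero_notMem_ccwCone u v w (h ▸ hs)

lemma smul_zAxis_mem_ccwCone_iff : σ • zAxis ∈ ccwCone u v w ↔
    (0 < det3 u v w ∧ 0 < σ * cross v w ∧ 0 < σ * cross w u ∧ 0 < σ * cross u v) ∨
      (det3 u v w < 0 ∧ (0 < σ * cross v w ∨ 0 < σ * cross w u ∨ 0 < σ * cross u v)) := by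
  simp only [ccwCone, Set.mem_ofPred_eq, det3_smul_zAxis_fst, det3_smul_zAxis_snd,
    det3_smul_zAxis_thd]

lemma isOpen_ccwCone (u v w : E3) : IsOpen (ccwCone u v w) := by
  have h (φ : E3 → ℝ) (hφ : IsLinearMap ℝ φ) : IsOpen {s | 0 < φ s} :=
    isOpen_lt continuous_const (hφ.mk' φ).continuous_of_finiteDimensional
  have hf := h _ (isLinearMap_det3_fst v w)
  have hs := h _ (isLinearMap_det3_snd u w)
  have ht := h _ (isLinearMap_det3_thd u v)
  exact (isOpen_const.inter (hf.inter (hs.inter ht))).union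
    (isOpen_const.inter (hf.union (hs.union ht)))

lemma sign_of_comb_mem_closure (hcl : a • u + b • v + c • w ∈ closure (ccwCone u v w)) :
    (0 < det3 u v w ∧ 0 ≤ a ∧ 0 ≤ b ∧ 0 ≤ c) ∨ (det3 u v w < 0 ∧ (a ≤ 0 ∨ b ≤ 0 ∨ c ≤ 0)) := by
  have closed (φ : E3 → ℝ) (hφ : IsLinearMap ℝ φ) : closure {s | 0 < φ s} ⊆ {s | 0 ≤ φ s} :=
    closure_lt_subset_le continuous_const (hφ.mk' φ).continuous_of_finiteDimensional
  have hf := closed _ (isLinearMap_det3_fst v w)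
  have hs := closed _ (isLinearMap_det3_snd u w)
  have ht := closed _ (isLinearMap_det3_thd u v)
  rcases lt_trichotomy (det3 u v w) 0 with hD | hD | hD
  · obtain ⟨ea, eb, ec⟩ := (eq_comb_iff hD.ne).1 (rfl : a • u + b • v + c • w = _)
    rw [ccwCone_of_neg hD, closure_union, closure_union] at hcl
    have hcl := hcl.imp (@hf _) (Or.imp (@hs _) (@ht _))
    simp only [Set.mem_ofPred_eq, ea, eb, ec] at hcl
    exact Or.inr ⟨hD, hcl.imp (nonpos_of_mul_nonneg_left · hD)
      (Or.imp (nonpos_of_mul_nonneg_left · hD) (nonpos_of_mul_nonneg_left · hD))⟩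
  · simp [ccwCone, hD] at hcl
  · obtain ⟨ea, eb, ec⟩ := (eq_comb_iff hD.ne').1 (rfl : a • u + b • v + c • w = _)
    rw [ccwCone_of_pos hD] at hcl
    obtain ⟨hcf, hcl⟩ := closure_inter_subset_inter_closure _ _ hcl
    obtain ⟨hcs, hct⟩ := closure_inter_subset_inter_closure _ _ hcl
    replace hcf := hf hcf
    replace hcs := hs hcs
    replace hct := ht hct
    simp only [Set.mem_ofPred_eq, ea, eb, ec, mul_nonneg_iff_of_pos_right hD] at hcf hcs hct
    exact Or.inl ⟨hD, hcf, hcs, hct⟩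

lemma exists_isBoundaryCoord_of_mem_frontier (hD : det3 u v w ≠ 0)
    (hs : s ∈ frontier (ccwCone u v w)) :
    ∃ a b c, IsBoundaryCoord a b c ∧ s = a • u + b • v + c • w := by
  obtain ⟨a, b, c, rfl⟩ := exists_eq_comb hD s
  rw [(isOpen_ccwCone u v w).frontier_eq] at hs
  refine ⟨a, b, c, ?_, rfl⟩
  have hnot := hs.2
  rw [comb_mem_ccwCone_iff, not_or] at hnot
  rcases sign_of_comb_mem_closure hs.1 with ⟨hD, hpos⟩ | ⟨hD, hneg⟩
  · refine ⟨hpos, ?_⟩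
    have h := not_and.1 hnot.1 hD
    simp only [not_and_or, not_lt] at h
    exact h.imp (le_antisymm · hpos.1) (Or.imp (le_antisymm · hpos.2.1) (le_antisymm · hpos.2.2))
  · have h := not_and.1 hnot.2 hD
    simp only [not_or, not_lt] at h
    exact ⟨h, hneg.imp (le_antisymm · h.1) (Or.imp (le_antisymm · h.2.1) (le_antisymm · h.2.2))⟩

lemma mem_closure_ccwCone (hD : det3 u v w ≠ 0) : u ∈ closure (ccwCone u v w) := by
  obtain ⟨x, hx⟩ : ∃ x : ℝ, ∀ t > (0 : ℝ), u + t • (x • (v + w)) ∈ ccwCone u v w := by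
    rcases hD.lt_or_gt with hD | hD
    · refine ⟨-1, fun t ht => ?_⟩
      rw [show u + t • (-1 : ℝ) • (v + w) = (1 : ℝ) • u + (-t) • v + (-t) • w by module,
        comb_mem_ccwCone_iff]
      simp [hD, ht]
    · refine ⟨1, fun t ht => ?_⟩
      rw [show u + t • (1 : ℝ) • (v + w) = (1 : ℝ) • u + t • v + t • w by module,
        comb_mem_ccwCone_iff]
      simp [hD, ht]
  have hlim : Filter.Tendsto (fun t : ℝ => u + t • (x • (v + w))) (nhdsWithin 0 (Set.Ioi 0))
      (nhds u) := by
    have hcont : Continuous fun t : ℝ => u + t • (x • (v + w)) := by fun_prop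
    simpa using (hcont.tendsto 0).mono_left nhdsWithin_le_nhds
  exact mem_closure_of_tendsto hlim (Filter.eventually_of_mem self_mem_nhdsWithin hx)

end Cones

section Winding

variable {u v w s : E3} {a b c h σ : ℝ}

/-- The three vectors wind once around the vertical axis, counterclockwise if `0 < σ` and clockwise
if `σ < 0`; only the sign of `σ` matters. -/
def Winds (σ : ℝ) (u v w : E3) : Prop :=
  0 < σ * cross u v ∧ 0 < σ * cross v w ∧ 0 < σ * cross w u

lemma Winds.rotate (hW : Winds σ u v w) : Winds σ v w u := ⟨hW.2.1, hW.2.2, hW.1⟩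

lemma Winds.mul_cross_pos_iff (hW : Winds σ u v w) : 0 < h * cross u v ↔ 0 < σ * h := by
  rcases pos_and_pos_or_neg_and_neg_of_mul_pos hW.1 with ⟨hσ, hc⟩ | ⟨hσ, hc⟩
  · rw [mul_pos_iff_of_pos_right hc, mul_pos_iff_of_pos_left hσ]
  · simp [mul_pos_iff, hσ, hc, hσ.not_gt, hc.not_gt]

lemma Winds.mul_cross_nonneg (hW : Winds σ u v w) (hh : 0 ≤ σ * h) : 0 ≤ h * cross u v := by
  by_contra! hlt
  have := hW.mul_cross_pos_iff.1 (show 0 < -h * cross u v by linarith)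
  linarith

lemma Winds.add_mem (hW : Winds σ u v w) (hs : s ∈ ccwCone u v w) (hh : 0 ≤ σ * h) :
    s + h • zAxis ∈ ccwCone u v w := by
  have huv := hW.mul_cross_nonneg hh
  have hvw := hW.rotate.mul_cross_nonneg hh
  have hwu := hW.rotate.rotate.mul_cross_nonneg hh
  simp only [ccwCone, Set.mem_ofPred_eq, det3_add_zAxis_fst, det3_add_zAxis_snd,
    det3_add_zAxis_thd] at hs ⊢
  exact hs.imp
    (fun ⟨hD, hu, hv, hw⟩ => ⟨hD, add_pos_of_pos_of_nonneg hu hvw,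
      add_pos_of_pos_of_nonneg hv hwu, add_pos_of_pos_of_nonneg hw huv⟩)
    (fun ⟨hD, hs⟩ => ⟨hD, hs.imp (add_pos_of_pos_of_nonneg · hvw)
      (Or.imp (add_pos_of_pos_of_nonneg · hwu) (add_pos_of_pos_of_nonneg · huv))⟩)

lemma Winds.boundary_add_mem_iff (hW : Winds σ u v w) (hD : det3 u v w ≠ 0)
    (habc : IsBoundaryCoord a b c) :
    a • u + b • v + c • w + h • zAxis ∈ ccwCone u v w ↔ 0 < σ * h := by
  obtain ⟨⟨ha, hb, hc⟩, hzero⟩ := habc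
  obtain ⟨ea, eb, ec⟩ := (eq_comb_iff hD).1 (rfl : a • u + b • v + c • w = _)
  simp only [ccwCone, Set.mem_ofPred_eq, det3_add_zAxis_fst, det3_add_zAxis_snd,
    det3_add_zAxis_thd, ea, eb, ec]
  have huv := hW.mul_cross_pos_iff (h := h)
  have hvw := hW.rotate.mul_cross_pos_iff (h := h)
  have hwu := hW.rotate.rotate.mul_cross_pos_iff (h := h)
  constructor
  · rintro (⟨-, hmem⟩ | ⟨hD, hmem⟩)
    · rcases hzero with rfl | rfl | rfl
      · exact hvw.1 (by linarith)
      · exact hwu.1 (by linarith)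
      · exact huv.1 (by linarith)
    · have hneg {x : ℝ} (hx : 0 ≤ x) : x * det3 u v w ≤ 0 :=
        mul_nonpos_of_nonneg_of_nonpos hx hD.le
      rcases hmem with hmem | hmem | hmem
      · exact hvw.1 (by linarith [hneg ha])
      · exact hwu.1 (by linarith [hneg hb])
      · exact huv.1 (by linarith [hneg hc])
  · intro hh
    rcases hD.lt_or_gt with hD | hD
    · refine Or.inr ⟨hD, hzero.imp ?_ (Or.imp ?_ ?_)⟩ <;> rintro rfl
      · linarith [hvw.2 hh]
      · linarith [hwu.2 hh]
      · linarith [huv.2 hh]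
    · have hpos {x : ℝ} (hx : 0 ≤ x) : 0 ≤ x * det3 u v w := mul_nonneg hx hD.le
      exact Or.inl ⟨hD, by linarith [hpos ha, hvw.2 hh], by linarith [hpos hb, hwu.2 hh],
        by linarith [hpos hc, huv.2 hh]⟩

lemma Winds.exists_boundary (hW : Winds σ u v w) (hD : det3 u v w ≠ 0) (s : E3) :
    ∃ k a b c : ℝ, IsBoundaryCoord a b c ∧ s + k • zAxis = a • u + b • v + c • w := by
  obtain ⟨a, b, c, rfl⟩ := exists_eq_comb hD s
  obtain ⟨t, ht⟩ := exists_isBoundaryCoord_add_mul hW.2.1 hW.2.2 hW.1 a b c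
  refine ⟨t * σ * det3 u v w, _, _, _, ht, ?_⟩
  rw [mul_smul, det3_smul_zAxis_eq]
  module

lemma winds_of_mem_ccwCone (hmem : σ • zAxis ∈ ccwCone u v w)
    (hnot : (-σ) • zAxis ∉ ccwCone u v w) (huv : cross u v ≠ 0) (hvw : cross v w ≠ 0)
    (hwu : cross w u ≠ 0) : Winds σ u v w := by
  have hσ : σ ≠ 0 := by
    rintro rfl
    exact zero_notMem_ccwCone u v w (by simpa using hmem)
  rw [smul_zAxis_mem_ccwCone_iff] at hmem hnot
  rcases hmem with ⟨-, h1, h2, h3⟩ | ⟨hD, -⟩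
  · exact ⟨h3, h1, h2⟩
  · simp only [hD, true_and, neg_mul, Left.neg_pos_iff, not_or, not_lt] at hnot
    exact ⟨hnot.2.2.2.lt_of_ne' (mul_ne_zero hσ huv), hnot.2.1.lt_of_ne' (mul_ne_zero hσ hvw),
      hnot.2.2.1.lt_of_ne' (mul_ne_zero hσ hwu)⟩

lemma isPreconnected_ccwCone_of_pos (hD : 0 < det3 u v w) : IsPreconnected (ccwCone u v w) := by
  rw [ccwCone_of_pos hD]
  exact ((convex_halfSpace_gt (isLinearMap_det3_fst v w) 0).inter
    ((convex_halfSpace_gt (isLinearMap_det3_snd u w) 0).inter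
      (convex_halfSpace_gt (isLinearMap_det3_thd u v) 0))).isPreconnected

lemma Winds.isPreconnected_ccwCone_of_neg (hW : Winds σ u v w) (hD : det3 u v w < 0) :
    IsPreconnected (ccwCone u v w) := by
  have star {x : ℝ} (φ : E3 → ℝ) (hφ : IsLinearMap ℝ φ) (hφz : φ (σ • zAxis) = x) (hx : 0 < x) :
      StarConvex ℝ (σ • zAxis) {s | 0 < φ s} :=
    (convex_halfSpace_gt hφ 0).starConvex (show 0 < φ (σ • zAxis) from hφz ▸ hx)
  have hf := star _ (isLinearMap_det3_fst v w) (det3_smul_zAxis_fst v w σ) hW.2.1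
  have hs := star _ (isLinearMap_det3_snd u w) (det3_smul_zAxis_snd u w σ) hW.2.2
  have ht := star _ (isLinearMap_det3_thd u v) (det3_smul_zAxis_thd u v σ) hW.1
  have hmem : σ • zAxis ∈ ccwCone u v w :=
    smul_zAxis_mem_ccwCone_iff.2 (Or.inr ⟨hD, Or.inl hW.2.1⟩)
  rw [ccwCone_of_neg hD] at hmem ⊢
  exact ((hf.union (hs.union ht)).isPathConnected hmem).isConnected.isPreconnected

end Winding

section Relations

variable {u v w : E3} {a b c : ℝ}

lemma exists_nonneg_comb (ha : a ≠ 0) (hab : a * b ≤ 0) (hac : a * c ≤ 0)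
    (h : a • u + b • v + c • w = 0) : ∃ x y : ℝ, 0 ≤ x ∧ 0 ≤ y ∧ u = x • v + y • w := by
  have nonneg {d : ℝ} (had : a * d ≤ 0) : 0 ≤ -(d / a) := by
    have := div_nonpos_of_nonpos_of_nonneg had (sq_nonneg a)
    rw [show d / a = a * d / a ^ 2 by field_simp]
    linarith
  refine ⟨_, _, nonneg hab, nonneg hac, smul_right_injective E3 ha ?_⟩
  simp only [smul_add, smul_smul, mul_neg, mul_div_cancel₀ _ ha]
  rw [eq_comm, ← sub_eq_zero, ← neg_eq_zero, ← h]
  module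

lemma winds_of_det3_eq_zero (hD : det3 u v w = 0) (huv : cross u v ≠ 0) (hvw : cross v w ≠ 0)
    (hwu : cross w u ≠ 0) (hu : ¬ ∃ x y : ℝ, 0 ≤ x ∧ 0 ≤ y ∧ u = x • v + y • w)
    (hv : ¬ ∃ x y : ℝ, 0 ≤ x ∧ 0 ≤ y ∧ v = x • w + y • u)
    (hw : ¬ ∃ x y : ℝ, 0 ≤ x ∧ 0 ≤ y ∧ w = x • u + y • v) :
    Winds 1 u v w ∨ Winds (-1) u v w := by
  have hrel : cross v w • u + cross w u • v + cross u v • w = 0 := by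
    rw [← det3_smul_zAxis_eq, hD, zero_smul]
  have hu' : ¬(cross v w * cross w u ≤ 0 ∧ cross v w * cross u v ≤ 0) := fun h =>
    hu (exists_nonneg_comb hvw h.1 h.2 hrel)
  have hv' : ¬(cross w u * cross u v ≤ 0 ∧ cross w u * cross v w ≤ 0) := fun h =>
    hv (exists_nonneg_comb hwu h.1 h.2 (by rw [← hrel]; abel))
  have hw' : ¬(cross u v * cross v w ≤ 0 ∧ cross u v * cross w u ≤ 0) := fun h =>
    hw (exists_nonneg_comb huv h.1 h.2 (by rw [← hrel]; abel))
  simp only [Winds, one_mul, neg_mul, Left.neg_pos_iff]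
  rcases huv.lt_or_gt with h1 | h1 <;> rcases hvw.lt_or_gt with h2 | h2 <;>
    rcases hwu.lt_or_gt with h3 | h3 <;>
    simp_all [mul_nonpos_iff, le_of_lt, not_le_of_gt]

end Relations

section Shears

variable {u v w s : E3}

/-- The vertical shear `s ↦ s + ⟪ν, s⟫ z`. -/
def shear (ν s : E3) : E3 := s + inner ℝ ν s • zAxis

lemma det3_shear (ν u v w : E3) :
    det3 (shear ν u) (shear ν v) (shear ν w) = (1 + ν 2) * det3 u v w := by
  simp [det3_eq, shear, inner_eq]; ring

lemma shear_mem_ccwCone_iff {ν : E3} (hν : 0 < 1 + ν 2) :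
    shear ν s ∈ ccwCone (shear ν u) (shear ν v) (shear ν w) ↔ s ∈ ccwCone u v w := by
  have neg_iff {x : ℝ} : (1 + ν 2) * x < 0 ↔ x < 0 := by simp [mul_neg_iff, hν, hν.not_gt]
  simp only [ccwCone, Set.mem_ofPred_eq, det3_shear, neg_iff, mul_pos_iff_of_pos_left hν]

end Shears

section Projection

variable {u v w s : E3}

/-- The radial projection to the unit sphere, with junk value `northPole` at the origin. -/
def toSphere (v : E3) : S2 :=
  if h : v = 0 then northPole else ⟨‖v‖⁻¹ • v, by simp [norm_smul, h]⟩

lemma coe_toSphere (hv : v ≠ 0) : (toSphere v : E3) = ‖v‖⁻¹ • v := by simp [toSphere, hv]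

lemma coe_ne_zero (x : S2) : (x : E3) ≠ 0 := ne_zero_of_mem_unit_sphere x

lemma toSphere_smul_coe (x : S2) {r : ℝ} (hr : 0 < r) : toSphere (r • (x : E3)) = x := by
  apply Subtype.ext
  rw [coe_toSphere (smul_ne_zero hr.ne' (coe_ne_zero x)), norm_smul, norm_eq_of_mem_sphere,
    smul_smul, Real.norm_of_nonneg hr.le, mul_one, inv_mul_cancel₀ hr.ne', one_smul]

lemma toSphere_coe (x : S2) : toSphere (x : E3) = x := by
  simpa using toSphere_smul_coe x one_pos

lemma norm_smul_toSphere (hv : v ≠ 0) : ‖v‖ • (toSphere v : E3) = v := by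
  rw [coe_toSphere hv, smul_inv_smul₀ (norm_ne_zero_iff.2 hv)]

lemma toSphere_smul {r : ℝ} (hr : 0 < r) (hv : v ≠ 0) : toSphere (r • v) = toSphere v := by
  conv_lhs => rw [← norm_smul_toSphere hv, smul_smul]
  exact toSphere_smul_coe _ (mul_pos hr (norm_pos_iff.2 hv))

lemma continuousOn_toSphere : ContinuousOn toSphere {0}ᶜ := by
  rw [continuousOn_iff_continuous_domRestrict, continuous_induced_rng]
  have heq : Subtype.val ∘ Set.domRestrict {0}ᶜ toSphere =
      fun v : ({0}ᶜ : Set E3) => ‖(v : E3)‖⁻¹ • (v : E3) := funext fun v => coe_toSphere v.2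
  rw [heq]
  exact (Continuous.inv₀ (by fun_prop) fun v => norm_ne_zero_iff.2 v.2).smul (by fun_prop)

lemma coe_northPole : (northPole : E3) = zAxis := rfl

lemma coe_southPole : (southPole : E3) = -zAxis := by
  ext m; fin_cases m <;> simp [southPole, zAxis]

lemma ccwCone_toSphere (hu : u ≠ 0) (hv : v ≠ 0) (hw : w ≠ 0) :
    ccwCone (toSphere u : E3) (toSphere v) (toSphere w) = ccwCone u v w := by
  ext s
  rw [coe_toSphere hu, coe_toSphere hv, coe_toSphere hw, ← one_smul ℝ s,
    ccwCone_smul_iff (by positivity) (by positivity) (by positivity) one_pos, one_smul]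

lemma toSphere_mem_ccwRegion_iff {u v w : S2} (hs : s ≠ 0) :
    toSphere s ∈ ccwRegion u v w ↔ s ∈ ccwCone (u : E3) v w := by
  rw [mem_ccwRegion, coe_toSphere hs]
  simpa only [one_smul] using
    ccwCone_smul_iff one_pos one_pos one_pos (inv_pos.2 (norm_pos_iff.2 hs))

lemma ccwCone_eq_of_ccwRegion_eq {u v w u' v' w' : S2}
    (h : ccwRegion u v w = ccwRegion u' v' w') :
    ccwCone (u : E3) v w = ccwCone (u' : E3) v' w' := by
  ext s
  rcases eq_or_ne s 0 with rfl | hs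
  · simp only [zero_notMem_ccwCone]
  · rw [← toSphere_mem_ccwRegion_iff hs, h, toSphere_mem_ccwRegion_iff hs]

lemma mem_arc_toSphere_iff (hu : u ≠ 0) (hv : v ≠ 0) {x : S2} :
    x ∈ arc (toSphere u) (toSphere v) ↔
      ∃ a b : ℝ, 0 ≤ a ∧ 0 ≤ b ∧ (x : E3) = a • u + b • v := by
  constructor
  · rintro ⟨a, b, ha, hb, h⟩
    refine ⟨a * ‖u‖⁻¹, b * ‖v‖⁻¹, by positivity, by positivity, ?_⟩
    rw [h, coe_toSphere hu, coe_toSphere hv, mul_smul, mul_smul]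
  · rintro ⟨a, b, ha, hb, h⟩
    refine ⟨a * ‖u‖, b * ‖v‖, by positivity, by positivity, ?_⟩
    rw [h, mul_smul, mul_smul, norm_smul_toSphere hu, norm_smul_toSphere hv]

lemma toSphere_mem_arc {u v : S2} {a b : ℝ} (ha : 0 ≤ a) (hb : 0 ≤ b)
    (hs : a • (u : E3) + b • (v : E3) ≠ 0) :
    toSphere (a • (u : E3) + b • (v : E3)) ∈ arc u v :=
  ⟨‖a • (u : E3) + b • (v : E3)‖⁻¹ * a, ‖a • (u : E3) + b • (v : E3)‖⁻¹ * b,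
    by positivity, by positivity, by rw [coe_toSphere hs, smul_add, mul_smul, mul_smul]⟩

lemma mem_arc_self_iff {u x : S2} : x ∈ arc u u ↔ x = u := by
  constructor
  · rintro ⟨a, b, ha, hb, h⟩
    rw [← add_smul] at h
    have hab : 0 < a + b := (add_nonneg ha hb).lt_of_ne' fun h0 =>
      coe_ne_zero x (by rw [h, h0, zero_smul])
    rw [← toSphere_coe x, h, toSphere_smul_coe u hab]
  · rintro rfl
    exact ⟨1, 0, zero_le_one, le_rfl, by simp⟩

lemma cross_smul_self (u : E3) (r : ℝ) : cross u (r • u) = 0 := by simp [cross]; ring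

lemma ne_zero_of_cross_ne_zero (h : cross u v ≠ 0) : u ≠ 0 := by
  rintro rfl
  simp [cross] at h

lemma toSphere_ne_of_cross_ne_zero (h : cross u v ≠ 0) (hv : v ≠ 0) :
    toSphere u ≠ toSphere v := by
  intro he
  have hu := ne_zero_of_cross_ne_zero h
  have hvu : v = (‖v‖ * ‖u‖⁻¹) • u := by
    rw [mul_smul, ← coe_toSphere hu, he, norm_smul_toSphere hv]
  rw [hvu, cross_smul_self] at h
  exact h rfl

lemma angle_lt_pi_of_cross_ne_zero (h : cross u v ≠ 0) :
    InnerProductGeometry.angle u v < Real.pi := by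
  refine (InnerProductGeometry.angle_le_pi u v).lt_of_ne fun he => ?_
  obtain ⟨-, r, -, rfl⟩ := InnerProductGeometry.angle_eq_pi_iff.1 he
  exact h (cross_smul_self u r)

lemma ccwRegion_eq_preimage (u v w : S2) :
    ccwRegion u v w = Subtype.val ⁻¹' ccwCone (u : E3) v w := Set.ext fun _ => mem_ccwRegion

lemma isOpen_ccwRegion (u v w : S2) : IsOpen (ccwRegion u v w) := by
  rw [ccwRegion_eq_preimage]
  exact (isOpen_ccwCone (u : E3) v w).preimage continuous_subtype_val

lemma isPreconnected_ccwRegion {u v w : S2} (h : IsPreconnected (ccwCone (u : E3) v w)) :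
    IsPreconnected (ccwRegion u v w) := by
  have himage : toSphere '' ccwCone (u : E3) v w = ccwRegion u v w := by
    ext x
    constructor
    · rintro ⟨s, hs, rfl⟩
      exact (toSphere_mem_ccwRegion_iff (ne_zero_of_mem_ccwCone hs)).2 hs
    · exact fun hx => ⟨x, mem_ccwRegion.1 hx, toSphere_coe x⟩
  exact himage ▸ h.image _ (continuousOn_toSphere.mono fun s => ne_zero_of_mem_ccwCone)

lemma exists_isBoundaryCoord_of_mem_frontier_ccwRegion {u v w x : S2}
    (hD : det3 (u : E3) v w ≠ 0) (hx : x ∈ frontier (ccwRegion u v w)) :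
    ∃ a b c : ℝ, IsBoundaryCoord a b c ∧
      (x : E3) = a • (u : E3) + b • (v : E3) + c • (w : E3) := by
  rw [ccwRegion_eq_preimage] at hx
  exact exists_isBoundaryCoord_of_mem_frontier hD
    (continuous_subtype_val.frontier_preimage_subset _ hx)

end Projection

section ConeDrawing

/-- The cone over the drawing of `G` with vertices in the directions `P i`. -/
def coneDrawing {V : Type*} (G : SimpleGraph V) (P : V → E3) : Set E3 :=
  {w | ∃ i j, (G.Adj i j ∨ i = j) ∧ ∃ a b : ℝ, 0 ≤ a ∧ 0 ≤ b ∧ w = a • P i + b • P j}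

lemma zero_mem_coneDrawing {V : Type*} [Nonempty V] (G : SimpleGraph V) (P : V → E3) :
    0 ∈ coneDrawing G P := by
  obtain ⟨i⟩ := ‹Nonempty V›
  exact ⟨i, i, Or.inr rfl, 0, 0, le_rfl, le_rfl, by simp⟩

lemma smul_mem_coneDrawing {V : Type*} {G : SimpleGraph V} {P : V → E3} {w : E3} {r : ℝ}
    (hr : 0 ≤ r) (hw : w ∈ coneDrawing G P) : r • w ∈ coneDrawing G P := by
  obtain ⟨i, j, hij, a, b, ha, hb, rfl⟩ := hw
  exact ⟨i, j, hij, r * a, r * b, by positivity, by positivity, by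
    rw [smul_add, smul_smul, smul_smul]⟩

variable {n : ℕ} {G : SimpleGraph (Fin n)} {p : Fin n → S2}

lemma mem_drawing_toSphere_iff {P : Fin n → E3} (hP : ∀ i, P i ≠ 0) {x : S2} :
    x ∈ drawing G (fun i => toSphere (P i)) ↔ (x : E3) ∈ coneDrawing G P := by
  simp only [drawing, coneDrawing, Set.mem_ofPred_eq, ← mem_arc_toSphere_iff (hP _) (hP _)]
  constructor
  · rintro (⟨i, hi⟩ | ⟨i, j, hij, h⟩)
    · exact ⟨i, i, Or.inr rfl, mem_arc_self_iff.2 hi⟩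
    · exact ⟨i, j, Or.inl hij, h⟩
  · rintro ⟨i, j, hij | rfl, h⟩
    · exact Or.inr ⟨i, j, hij, h⟩
    · exact Or.inl ⟨i, mem_arc_self_iff.1 h⟩

lemma toSphere_mem_drawing_iff {w : E3} (hw : w ≠ 0) :
    toSphere w ∈ drawing G p ↔ w ∈ coneDrawing G (fun i => (p i : E3)) := by
  have h := mem_drawing_toSphere_iff (G := G) (fun i => coe_ne_zero (p i)) (x := toSphere w)
  simp only [toSphere_coe] at h
  rw [h]
  refine ⟨fun h => norm_smul_toSphere hw ▸ smul_mem_coneDrawing (norm_nonneg w) h, fun h => ?_⟩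
  exact coe_toSphere hw ▸ smul_mem_coneDrawing (by positivity) h

end ConeDrawing

section Topology

lemma exists_mem_frontier_of_isPreconnected {X : Type*} [TopologicalSpace X] {K U : Set X}
    (hK : IsPreconnected K) (hU : IsOpen U) {x y : X} (hx : x ∈ K) (hxU : x ∈ U) (hy : y ∈ K)
    (hyU : y ∉ U) : ∃ z ∈ K, z ∈ frontier U := by
  by_contra! hfr
  refine hyU (hK.subset_of_closure_inter_subset hU ⟨x, hx, hxU⟩ (fun z ⟨hzcl, hz⟩ => ?_) hy)
  by_contra hzU
  exact hfr z hz (hU.frontier_eq ▸ ⟨hzcl, hzU⟩)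

lemma connectedComponentIn_eq_of_frontier_disjoint {X : Type*} [TopologicalSpace X]
    {F U : Set X} {x : X} (hU : IsPreconnected U) (ho : IsOpen U) (hUF : U ⊆ F)
    (hfr : Disjoint (frontier U) F) (hx : x ∈ U) : connectedComponentIn F x = U := by
  refine Set.Subset.antisymm ?_ (hU.subset_connectedComponentIn hx hUF)
  intro y hy
  by_contra hyU
  obtain ⟨z, hz, hzfr⟩ := exists_mem_frontier_of_isPreconnected isPreconnected_connectedComponentIn
    ho (mem_connectedComponentIn (hUF hx)) hx hy hyU
  exact hfr.le_bot ⟨hzfr, connectedComponentIn_subset F x hz⟩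

lemma exists_mem_uIcc_mem_frontier {U : Set E3} (hU : IsOpen U) {u w : E3} {s : ℝ} (hu : u ∈ U)
    (hus : u + s • w ∉ U) : ∃ t ∈ Set.uIcc 0 s, u + t • w ∈ frontier U := by
  have hK : IsPreconnected ((fun t : ℝ => u + t • w) '' Set.uIcc 0 s) :=
    isPreconnected_uIcc.image _ (by fun_prop)
  obtain ⟨_, ⟨t, ht, rfl⟩, hfr⟩ := exists_mem_frontier_of_isPreconnected hK hU
    ⟨0, Set.left_mem_uIcc, by simp⟩ hu ⟨s, Set.right_mem_uIcc, rfl⟩ hus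
  exact ⟨t, ht, hfr⟩

end Topology

section Embedding

variable {n : ℕ} {G : SimpleGraph (Fin n)} {p : Fin n → S2}

lemma IsShortestPathEmbedding.eq_or_swap_or_vertex (he : IsShortestPathEmbedding G p)
    {i j k l : Fin n} (hij : G.Adj i j ∨ i = j) (hkl : G.Adj k l ∨ k = l) {x : S2}
    (hx : x ∈ arc (p i) (p j)) (hx' : x ∈ arc (p k) (p l)) :
    (i = k ∧ j = l) ∨ (i = l ∧ j = k) ∨ ∃ m, (m = i ∨ m = j) ∧ (m = k ∨ m = l) ∧ x = p m := by
  rcases hij with hij | rfl <;> rcases hkl with hkl | rfl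
  · by_cases hs : s(i, j) = s(k, l)
    · exact (Sym2.eq_iff.1 hs).imp_right Or.inl
    · exact Or.inr (Or.inr (he.edge_edge i j k l hij hkl hs x hx hx'))
  · obtain rfl := mem_arc_self_iff.1 hx'
    exact Or.inr (Or.inr ⟨k, he.vertex_edge i j k hij hx, Or.inl rfl, rfl⟩)
  · obtain rfl := mem_arc_self_iff.1 hx
    exact Or.inr (Or.inr ⟨i, Or.inl rfl, he.vertex_edge k l i hkl hx', rfl⟩)
  · obtain rfl := mem_arc_self_iff.1 hx
    have hik := he.injective (mem_arc_self_iff.1 hx')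
    exact Or.inl ⟨hik, hik⟩

end Embedding

section Faces

variable {n : ℕ} {G : SimpleGraph (Fin n)} {p : Fin n → S2} {i j k : Fin n} {w : E3}

lemma isNorthFace_iff :
    IsNorthFace G p i j k ↔
      IsFace G p i j k ∧ (1 : ℝ) • zAxis ∈ ccwCone (p i : E3) (p j) (p k) := by
  rw [IsNorthFace, mem_ccwRegion, coe_northPole, one_smul]

lemma isSouthFace_iff :
    IsSouthFace G p i j k ↔
      IsFace G p i j k ∧ (-1 : ℝ) • zAxis ∈ ccwCone (p i : E3) (p j) (p k) := by
  rw [IsSouthFace, mem_ccwRegion, coe_southPole, neg_one_smul]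

lemma IsFace.rotate (hf : IsFace G p i j k) : IsFace G p j k i := by
  obtain ⟨hij, hjk, hki, hF⟩ := hf
  refine ⟨hjk, hki, hij, ?_⟩
  rwa [ccwRegion_eq_preimage, ← ccwCone_rotate, ← ccwRegion_eq_preimage]

lemma IsNorthFace.rotate (hN : IsNorthFace G p i j k) : IsNorthFace G p j k i := by
  rw [isNorthFace_iff] at hN ⊢
  exact ⟨hN.1.rotate, by rw [← ccwCone_rotate]; exact hN.2⟩

lemma IsFace.notMem_coneDrawing (hf : IsFace G p i j k)
    (hw : w ∈ ccwCone (p i : E3) (p j) (p k)) : w ∉ coneDrawing G (p ·) := by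
  obtain ⟨-, -, -, x, -, hx⟩ := hf
  have hw0 := ne_zero_of_mem_ccwCone hw
  rw [← toSphere_mem_ccwRegion_iff hw0, hx] at hw
  rw [← toSphere_mem_drawing_iff hw0]
  exact connectedComponentIn_subset _ _ hw

/-- No face contains both poles. -/
def HasDistinctPolarFaces (G : SimpleGraph (Fin n)) (p : Fin n → S2) : Prop :=
  ∀ i j k, ¬ (IsNorthFace G p i j k ∧ IsSouthFace G p i j k)

end Faces

section GenericTriangulation

variable {n : ℕ} {G : SimpleGraph (Fin n)} {p : Fin n → S2} {i j k : Fin n} {w : E3}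

lemma IsGenericTriangulation.nontrivial (hp : IsGenericTriangulation G p) :
    Nontrivial (Fin n) := by
  by_contra hn
  rw [not_nontrivial_iff_subsingleton] at hn
  have no_adj (i j : Fin n) : ¬ G.Adj i j := fun hij => hij.ne (Subsingleton.elim i j)
  have mem_drawing (x : S2) : x ∈ drawing G p := by
    by_contra hx
    obtain ⟨i, j, -, hij, -⟩ := hp.triangular _ ⟨x, hx, rfl⟩
    exact no_adj i j hij
  obtain ⟨i, hi⟩ := (mem_drawing northPole).resolve_right fun ⟨i, j, hij, _⟩ => no_adj i j hij
  obtain ⟨j, hj⟩ := (mem_drawing southPole).resolve_right fun ⟨i, j, hij, _⟩ => no_adj i j hij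
  have hpoles : (northPole : E3) = southPole := by rw [hi, hj, Subsingleton.elim i j]
  have : (1 : ℝ) = -1 := by simpa [coe_northPole, coe_southPole] using congrArg (· 2) hpoles
  norm_num at this

lemma IsGenericTriangulation.det3_ne_zero (hp : IsGenericTriangulation G p)
    (hij : i ≠ j) (hjk : j ≠ k) (hki : k ≠ i) : det3 (p i : E3) (p j) (p k) ≠ 0 := by
  intro hD
  obtain ⟨ν, hν, hi, hj, hk⟩ := det3_eq_zero_iff.1 hD
  have hsub : ({i, j, k} : Set (Fin n)) ⊆ {m | p m ∈ greatCircle ν} := by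
    rintro m (rfl | rfl | rfl) <;> assumption
  have hcard := (Set.ncard_le_ncard hsub).trans (hp.generic ν hν)
  rw [Set.ncard_eq_three.2 ⟨i, j, k, hij, hki.symm, hjk, rfl⟩] at hcard
  omega

lemma IsGenericTriangulation.cross_ne_zero (hp : IsGenericTriangulation G p) (hij : i ≠ j) :
    cross (p i : E3) (p j) ≠ 0 := by
  intro hc
  obtain ⟨ν, hν, hν2, hi, hj⟩ := exists_horizontal_of_cross_eq_zero hc
  have hsub : ({i, j} : Set (Fin n)) ⊆ {m | p m ∈ greatCircle ν} := by
    rintro m (rfl | rfl) <;> assumption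
  have hcard := (Set.ncard_le_ncard hsub).trans (hp.generic_pole ν hν
    (by simp [greatCircle, coe_northPole, inner_eq, hν2])
    (by simp [greatCircle, coe_southPole, inner_eq, hν2]))
  rw [Set.ncard_pair hij] at hcard
  omega

lemma IsGenericTriangulation.comb_eq_zero_of_eq_smul_zAxis (hp : IsGenericTriangulation G p)
    {M : Type*} [AddCommGroup M] [Module ℝ M] {a b r : ℝ}
    (h : a • (p i : E3) + b • (p j : E3) = r • zAxis) (R : Fin n → M) :
    a • R i + b • R j = 0 := by
  have hcross (m : Fin n) : a * cross (p i) (p m) + b * cross (p j) (p m) = 0 := by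
    have h0 := congrArg (· 0) h
    have h1 := congrArg (· 1) h
    simp only [PiLp.add_apply, PiLp.smul_apply, smul_eq_mul, zAxis_zero, zAxis_one,
      mul_zero] at h0 h1
    simp only [cross]
    linear_combination (p m : E3) 1 * h0 - (p m : E3) 0 * h1
  have hself (m : Fin n) : cross (p m : E3) (p m) = 0 := by simp [cross, mul_comm]
  -- Distinct vertex directions are independent modulo the axis.
  rcases eq_or_ne i j with rfl | hij
  · have := hp.nontrivial
    obtain ⟨m, hm⟩ := exists_ne i
    have hab : a + b = 0 := by
      simpa only [← add_mul, mul_eq_zero, hp.cross_ne_zero hm.symm, or_false] using hcross m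
    rw [← add_smul, hab, zero_smul]
  · have ha : a = 0 := by simpa [hself, hp.cross_ne_zero hij] using hcross j
    have hb : b = 0 := by simpa [hself, hp.cross_ne_zero hij.symm] using hcross i
    simp [ha, hb]

lemma IsGenericTriangulation.comb_congr (hp : IsGenericTriangulation G p)
    {M : Type*} [AddCommGroup M] [Module ℝ M] {a b c d : ℝ}
    (h : a • (p i : E3) + b • (p j : E3) = c • (p i : E3) + d • (p j : E3)) (R : Fin n → M) :
    a • R i + b • R j = c • R i + d • R j := by
  have hzero : (a - c) • (p i : E3) + (b - d) • (p j : E3) = (0 : ℝ) • zAxis := by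
    linear_combination (norm := module) h
  linear_combination (norm := module) hp.comb_eq_zero_of_eq_smul_zAxis hzero R

lemma IsGenericTriangulation.smul_zAxis_notMem_coneDrawing (hp : IsGenericTriangulation G p)
    {r : ℝ} (hr : r ≠ 0) : r • zAxis ∉ coneDrawing G (p ·) := by
  rintro ⟨i, j, -, a, b, -, -, h⟩
  exact smul_zAxis_ne_zero hr
    (h.trans (hp.comb_eq_zero_of_eq_smul_zAxis h.symm fun i => (p i : E3)))

lemma IsGenericTriangulation.finite_vertical_line_inter_coneDrawing
    (hp : IsGenericTriangulation G p) (w : E3) :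
    {h : ℝ | w + h • zAxis ∈ coneDrawing G (p ·)}.Finite := by
  have hsub : {h : ℝ | w + h • zAxis ∈ coneDrawing G (p ·)} ⊆ ⋃ i, ⋃ j,
      {h : ℝ | ∃ a b : ℝ, w + h • zAxis = a • (p i : E3) + b • (p j : E3)} := by
    rintro h ⟨i, j, -, a, b, -, -, hw⟩
    exact Set.mem_iUnion₂.2 ⟨i, j, a, b, hw⟩
  refine (Set.finite_iUnion fun i => Set.finite_iUnion fun j =>
    Set.Subsingleton.finite ?_).subset hsub
  rintro h ⟨a, b, hw⟩ h' ⟨a', b', hw'⟩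
  have hdiff : (a - a') • (p i : E3) + (b - b') • (p j : E3) = (h - h') • zAxis := by
    linear_combination (norm := module) hw' - hw
  by_contra hne
  exact smul_zAxis_ne_zero (sub_ne_zero.2 hne)
    (hdiff.symm.trans (hp.comb_eq_zero_of_eq_smul_zAxis hdiff fun i => (p i : E3)))

lemma IsGenericTriangulation.exists_face_of_isPreconnected (hp : IsGenericTriangulation G p)
    {K : Set E3} (hK : IsPreconnected K) (hne : K.Nonempty)
    (hdisj : ∀ w ∈ K, w ∉ coneDrawing G (p ·)) :
    ∃ i j k, IsFace G p i j k ∧ K ⊆ ccwCone (p i : E3) (p j) (p k) := by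
  have := hp.nontrivial
  have ne_zero (w : E3) (hw : w ∈ K) : w ≠ 0 := by
    rintro rfl
    exact hdisj 0 hw (zero_mem_coneDrawing G _)
  obtain ⟨w, hw⟩ := hne
  have hK' : IsPreconnected (toSphere '' K) := hK.image _ (continuousOn_toSphere.mono ne_zero)
  have hsub : toSphere '' K ⊆ (drawing G p)ᶜ := by
    rintro _ ⟨v, hv, rfl⟩
    rw [Set.mem_compl_iff, toSphere_mem_drawing_iff (ne_zero v hv)]
    exact hdisj v hv
  have hF : IsFaceSet G p (connectedComponentIn (drawing G p)ᶜ (toSphere w)) :=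
    ⟨_, hsub ⟨w, hw, rfl⟩, rfl⟩
  obtain ⟨i, j, k, hij, hjk, hki, heq⟩ := hp.triangular _ hF
  refine ⟨i, j, k, ⟨hij, hjk, hki, heq ▸ hF⟩, fun v hv => ?_⟩
  rw [← toSphere_mem_ccwRegion_iff (ne_zero v hv), ← heq]
  exact hK'.subset_connectedComponentIn ⟨w, hw, rfl⟩ hsub ⟨v, hv, rfl⟩

lemma IsGenericTriangulation.exists_face_mem (hp : IsGenericTriangulation G p)
    (hw : w ∉ coneDrawing G (p ·)) :
    ∃ i j k, IsFace G p i j k ∧ w ∈ ccwCone (p i : E3) (p j) (p k) := by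
  obtain ⟨i, j, k, hf, hsub⟩ := hp.exists_face_of_isPreconnected
    (isPreconnected_singleton (x := w)) (Set.singleton_nonempty w) (by rintro _ rfl; exact hw)
  exact ⟨i, j, k, hf, hsub rfl⟩

lemma IsGenericTriangulation.exists_northFace (hp : IsGenericTriangulation G p) :
    ∃ i j k, IsNorthFace G p i j k := by
  simpa only [isNorthFace_iff] using
    hp.exists_face_mem (hp.smul_zAxis_notMem_coneDrawing one_ne_zero)

lemma IsGenericTriangulation.exists_southFace (hp : IsGenericTriangulation G p) :
    ∃ i j k, IsSouthFace G p i j k := by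
  simpa only [isSouthFace_iff] using
    hp.exists_face_mem (hp.smul_zAxis_notMem_coneDrawing (neg_ne_zero.2 one_ne_zero))

lemma IsFace.det3_ne_zero (hf : IsFace G p i j k) (hp : IsGenericTriangulation G p) :
    det3 (p i : E3) (p j) (p k) ≠ 0 :=
  hp.det3_ne_zero hf.1.ne hf.2.1.ne hf.2.2.1.ne

lemma IsFace.winds (hf : IsFace G p i j k) (hp : IsGenericTriangulation G p) {σ : ℝ}
    (hmem : σ • zAxis ∈ ccwCone (p i : E3) (p j) (p k))
    (hnot : (-σ) • zAxis ∉ ccwCone (p i : E3) (p j) (p k)) : Winds σ (p i : E3) (p j) (p k) :=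
  winds_of_mem_ccwCone hmem hnot (hp.cross_ne_zero hf.1.ne) (hp.cross_ne_zero hf.2.1.ne)
    (hp.cross_ne_zero hf.2.2.1.ne)

lemma IsNorthFace.winds (hN : IsNorthFace G p i j k) (hp : IsGenericTriangulation G p)
    (hpoles : HasDistinctPolarFaces G p) : Winds 1 (p i : E3) (p j) (p k) :=
  hN.1.winds hp (isNorthFace_iff.1 hN).2 fun hS =>
    hpoles i j k ⟨hN, isSouthFace_iff.2 ⟨hN.1, hS⟩⟩

lemma IsSouthFace.winds (hS : IsSouthFace G p i j k) (hp : IsGenericTriangulation G p)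
    (hpoles : HasDistinctPolarFaces G p) : Winds (-1) (p i : E3) (p j) (p k) :=
  hS.1.winds hp (isSouthFace_iff.1 hS).2 fun hN =>
    hpoles i j k ⟨isNorthFace_iff.2 ⟨hS.1, by rwa [neg_neg] at hN⟩, hS⟩

lemma IsNonPolarFace.det3_pos (hf : IsNonPolarFace G p i j k) (hp : IsGenericTriangulation G p) :
    0 < det3 (p i : E3) (p j) (p k) := by
  obtain ⟨hf, hN, hS⟩ := hf
  by_contra! hD
  replace hD := hD.lt_of_ne (hf.det3_ne_zero hp)
  rcases (hp.cross_ne_zero hf.1.ne).lt_or_gt with hc | hc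
  · exact hS (isSouthFace_iff.2 ⟨hf, smul_zAxis_mem_ccwCone_iff.2
      (Or.inr ⟨hD, Or.inr (Or.inr (by linarith))⟩)⟩)
  · exact hN (isNorthFace_iff.2 ⟨hf, smul_zAxis_mem_ccwCone_iff.2
      (Or.inr ⟨hD, Or.inr (Or.inr (by linarith))⟩)⟩)

lemma IsFace.nonPolar_or_winds (hf : IsFace G p i j k) (hp : IsGenericTriangulation G p)
    (hpoles : HasDistinctPolarFaces G p) :
    IsNonPolarFace G p i j k ∨ ∃ σ, Winds σ (p i : E3) (p j) (p k) := by
  by_cases hN : IsNorthFace G p i j k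
  · exact Or.inr ⟨1, hN.winds hp hpoles⟩
  by_cases hS : IsSouthFace G p i j k
  · exact Or.inr ⟨-1, hS.winds hp hpoles⟩
  exact Or.inl ⟨hf, hN, hS⟩

lemma IsGenericTriangulation.exists_nonPolarFace_between (hp : IsGenericTriangulation G p)
    (hpoles : HasDistinctPolarFaces G p) {s : ℝ} (hs : 0 < s) (hw : w ∈ coneDrawing G (p ·))
    (hws : w + s • zAxis ∈ coneDrawing G (p ·))
    (hcons : ∀ t ∈ Set.Ioo 0 s, w + t • zAxis ∉ coneDrawing G (p ·)) :
    ∃ i j k, IsNonPolarFace G p i j k ∧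
      ∀ t ∈ Set.Ioo 0 s, w + t • zAxis ∈ ccwCone (p i : E3) (p j) (p k) := by
  have hK : IsPreconnected ((fun t : ℝ => w + t • zAxis) '' Set.Ioo 0 s) :=
    isPreconnected_Ioo.image _ (by fun_prop)
  obtain ⟨i, j, k, hf, hsub⟩ := hp.exists_face_of_isPreconnected hK
    ((Set.nonempty_Ioo.2 hs).image _) (Set.forall_mem_image.2 hcons)
  replace hsub := Set.forall_mem_image.1 (fun x hx => hsub hx)
  have hmid := hsub (show s / 2 ∈ Set.Ioo 0 s from ⟨by linarith, by linarith⟩)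
  refine ⟨i, j, k, (hf.nonPolar_or_winds hp hpoles).resolve_right ?_, fun t ht => hsub ht⟩
  rintro ⟨σ, hW⟩
  rcases le_total 0 σ with hσ | hσ
  · have hup := hW.add_mem hmid (h := s / 2) (by positivity)
    rw [add_assoc, ← add_smul, add_halves] at hup
    exact hf.notMem_coneDrawing hup hws
  · have hdown := hW.add_mem hmid (h := -(s / 2)) (by nlinarith)
    rw [add_assoc, ← add_smul, add_neg_cancel, zero_smul, add_zero] at hdown
    exact hf.notMem_coneDrawing hdown hw

lemma IsNorthFace.vertex_eq {i' j' k' : Fin n} (hN : IsNorthFace G p i j k)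
    (hN' : IsNorthFace G p i' j' k') (hp : IsGenericTriangulation G p) :
    i' = i ∨ i' = j ∨ i' = k := by
  have hregion : ccwRegion (p i') (p j') (p k') = ccwRegion (p i) (p j) (p k) := by
    obtain ⟨⟨-, -, -, x, -, hx⟩, hmem⟩ := hN
    obtain ⟨⟨-, -, -, x', -, hx'⟩, hmem'⟩ := hN'
    rw [hx] at hmem ⊢
    rw [hx'] at hmem' ⊢
    rw [connectedComponentIn_eq hmem, connectedComponentIn_eq hmem']
  have hcl := mem_closure_ccwCone (hN'.1.det3_ne_zero hp)
  rw [ccwCone_eq_of_ccwRegion_eq hregion] at hcl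
  have hnot : (p i' : E3) ∉ ccwCone (p i : E3) (p j) (p k) := fun hmem =>
    hN.1.notMem_coneDrawing hmem ⟨i', i', Or.inr rfl, 1, 0, zero_le_one, le_rfl, by simp⟩
  have hfr : (p i' : E3) ∈ frontier (ccwCone (p i : E3) (p j) (p k)) := by
    rw [(isOpen_ccwCone _ _ _).frontier_eq]
    exact ⟨hcl, hnot⟩
  obtain ⟨a, b, c, ⟨⟨ha, hb, hc⟩, hzero⟩, heq⟩ :=
    exists_isBoundaryCoord_of_mem_frontier (hN.1.det3_ne_zero hp) hfr
  rcases hzero with rfl | rfl | rfl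
  · exact Or.inr (hp.embedding.vertex_edge j k i' hN.1.2.1 ⟨b, c, hb, hc, by simpa using heq⟩)
  · have := hp.embedding.vertex_edge k i i' hN.1.2.2.1
      ⟨c, a, hc, ha, by simpa [add_comm] using heq⟩
    tauto
  · have := hp.embedding.vertex_edge i j i' hN.1.1 ⟨a, b, ha, hb, by simpa using heq⟩
    tauto

end GenericTriangulation

section Lifts

variable {n : ℕ} {G : SimpleGraph (Fin n)} {p : Fin n → S2} {η : Fin n → ℝ} {i j k : Fin n}
  {w v : E3} {h h' : ℝ}

/-- The vertices `p i`, moved vertically by `η i`. -/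
def shift (p : Fin n → S2) (η : Fin n → ℝ) (i : Fin n) : E3 := (p i : E3) + η i • zAxis

lemma cross_shift (i j : Fin n) : cross (shift p η i) (shift p η j) = cross (p i) (p j) := by
  simp [cross, shift]

lemma Winds.shift {σ : ℝ} (hW : Winds σ (p i : E3) (p j) (p k)) (η : Fin n → ℝ) :
    Winds σ (shift p η i) (shift p η j) (shift p η k) := by
  simpa only [Winds, cross_shift] using hW

/-- The point `w` of the cone over the drawing moves up by `h` if the displacements `η` of the
vertices are extended linearly to the edges. -/
def LiftsBy (G : SimpleGraph (Fin n)) (p : Fin n → S2) (η : Fin n → ℝ) (w : E3) (h : ℝ) : Prop :=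
  ∃ i j, (G.Adj i j ∨ i = j) ∧ ∃ a b : ℝ, 0 ≤ a ∧ 0 ≤ b ∧
    w = a • (p i : E3) + b • (p j : E3) ∧ h = a * η i + b * η j

lemma LiftsBy.mem_coneDrawing (hL : LiftsBy G p η w h) : w ∈ coneDrawing G (p ·) := by
  obtain ⟨i, j, hij, a, b, ha, hb, hw, -⟩ := hL
  exact ⟨i, j, hij, a, b, ha, hb, hw⟩

lemma exists_liftsBy (hw : w ∈ coneDrawing G (p ·)) (η : Fin n → ℝ) :
    ∃ h, LiftsBy G p η w h := by
  obtain ⟨i, j, hij, a, b, ha, hb, hw⟩ := hw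
  exact ⟨_, i, j, hij, a, b, ha, hb, hw, rfl⟩

lemma comb_shift (a b : ℝ) (i j : Fin n) : a • shift p η i + b • shift p η j =
    a • (p i : E3) + b • (p j : E3) + (a * η i + b * η j) • zAxis := by
  simp only [shift]; module

lemma mem_coneDrawing_shift_iff : v ∈ coneDrawing G (shift p η) ↔
    ∃ w h, LiftsBy G p η w h ∧ v = w + h • zAxis := by
  constructor
  · rintro ⟨i, j, hij, a, b, ha, hb, rfl⟩
    exact ⟨_, _, ⟨i, j, hij, a, b, ha, hb, rfl, rfl⟩, comb_shift a b i j⟩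
  · rintro ⟨_, _, ⟨i, j, hij, a, b, ha, hb, rfl, rfl⟩, rfl⟩
    exact ⟨i, j, hij, a, b, ha, hb, (comb_shift a b i j).symm⟩

lemma liftsBy_vertex {r : ℝ} (hr : 0 ≤ r) (i : Fin n) :
    LiftsBy G p η (r • (p i : E3)) (r * η i) :=
  ⟨i, i, Or.inr rfl, r, 0, hr, le_rfl, by simp, by simp⟩

lemma IsFace.liftsBy_of_isBoundaryCoord (hf : IsFace G p i j k) {a b c : ℝ}
    (habc : IsBoundaryCoord a b c) :
    LiftsBy G p η (a • (p i : E3) + b • (p j : E3) + c • (p k : E3))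
      (a * η i + b * η j + c * η k) := by
  obtain ⟨⟨ha, hb, hc⟩, rfl | rfl | rfl⟩ := habc
  · exact ⟨j, k, Or.inl hf.2.1, b, c, hb, hc, by simp, by simp⟩
  · exact ⟨k, i, Or.inl hf.2.2.1, c, a, hc, ha, by simp [add_comm], by ring⟩
  · exact ⟨i, j, Or.inl hf.1, a, b, ha, hb, by simp, by simp⟩

lemma IsFace.liftsBy_of_mem_frontier (hf : IsFace G p i j k) (hp : IsGenericTriangulation G p)
    {ν : E3} (hi : inner ℝ ν (p i : E3) = η i) (hj : inner ℝ ν (p j : E3) = η j)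
    (hk : inner ℝ ν (p k : E3) = η k) (hw : w ∈ frontier (ccwCone (p i : E3) (p j) (p k))) :
    LiftsBy G p η w (inner ℝ ν w) := by
  obtain ⟨a, b, c, habc, rfl⟩ :=
    exists_isBoundaryCoord_of_mem_frontier (hf.det3_ne_zero hp) hw
  simpa only [inner_add_right, inner_smul_right, hi, hj, hk] using
    hf.liftsBy_of_isBoundaryCoord (η := η) habc

lemma IsGenericTriangulation.comb_eq_mul_vertex (hp : IsGenericTriangulation G p) {m : Fin n}
    {a b r : ℝ} (hm : m = i ∨ m = j) (hw : a • (p i : E3) + b • (p j : E3) = r • (p m : E3)) :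
    a * η i + b * η j = r * η m := by
  rcases hm with rfl | rfl
  · simpa using hp.comb_congr (c := r) (d := 0) (by simpa using hw) η
  · simpa using hp.comb_congr (c := 0) (d := r) (by simpa using hw) η

lemma LiftsBy.unique (hp : IsGenericTriangulation G p) (hL : LiftsBy G p η w h)
    (hL' : LiftsBy G p η w h') : h = h' := by
  obtain ⟨i, j, hij, a, b, ha, hb, hw, rfl⟩ := hL
  obtain ⟨k, l, hkl, c, d, hc, hd, hw', rfl⟩ := hL'
  rcases eq_or_ne w 0 with rfl | hw0
  · have lift_zero {i j : Fin n} {a b : ℝ} (h0 : (0 : E3) = a • (p i : E3) + b • (p j : E3)) :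
        a * η i + b * η j = 0 := by
      simpa using hp.comb_congr (c := 0) (d := 0) (by simpa using h0.symm) η
    rw [lift_zero hw, lift_zero hw']
  rcases hp.embedding.eq_or_swap_or_vertex hij hkl (hw ▸ toSphere_mem_arc ha hb (hw ▸ hw0))
    (hw' ▸ toSphere_mem_arc hc hd (hw' ▸ hw0)) with ⟨rfl, rfl⟩ | ⟨rfl, rfl⟩ | ⟨m, hm, hm', hmw⟩
  · exact hp.comb_congr (hw.symm.trans hw') η
  · rw [add_comm (c * _)]
    exact hp.comb_congr (hw.symm.trans (hw'.trans (add_comm _ _))) η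
  · have hwm : w = ‖w‖ • (p m : E3) := by rw [← hmw, norm_smul_toSphere hw0]
    rw [hp.comb_eq_mul_vertex hm (hw.symm.trans hwm),
      hp.comb_eq_mul_vertex hm' (hw'.symm.trans hwm)]

end Lifts

section PositiveShifts

variable {n : ℕ} {G : SimpleGraph (Fin n)} {p : Fin n → S2} {η : Fin n → ℝ} {i j k : Fin n}
  {w v : E3} {s h h' : ℝ}

/-- The vertical displacements `η` of the vertices keep every non-polar face positively
oriented. -/
def IsPositiveShift (G : SimpleGraph (Fin n)) (p : Fin n → S2) (η : Fin n → ℝ) : Prop :=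
  ∀ i j k, IsNonPolarFace G p i j k → 0 < det3 (shift p η i) (shift p η j) (shift p η k)

lemma IsPositiveShift.exists_shear (hη : IsPositiveShift G p η) (hp : IsGenericTriangulation G p)
    (hf : IsNonPolarFace G p i j k) : ∃ ν : E3, 0 < 1 + ν 2 ∧ inner ℝ ν (p i : E3) = η i ∧
      inner ℝ ν (p j : E3) = η j ∧ inner ℝ ν (p k : E3) = η k := by
  have hD := hf.det3_pos hp
  obtain ⟨ν, hi, hj, hk⟩ := exists_inner_eq hD.ne' (η i) (η j) (η k)
  have hD' := det3_shear ν (p i) (p j) (p k)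
  simp only [shear, hi, hj, hk] at hD'
  exact ⟨ν, pos_of_mul_pos_left (hD' ▸ hη i j k hf) hD.le, hi, hj, hk⟩

lemma inner_add_smul_zAxis (ν w : E3) (t : ℝ) :
    inner ℝ ν (w + t • zAxis) = inner ℝ ν w + t * ν 2 := by
  simp [inner_eq]; ring

lemma shear_mem_ccwCone_shift_iff {ν : E3} (hν : 0 < 1 + ν 2) (hi : inner ℝ ν (p i : E3) = η i)
    (hj : inner ℝ ν (p j : E3) = η j) (hk : inner ℝ ν (p k : E3) = η k) :
    shear ν w ∈ ccwCone (shift p η i) (shift p η j) (shift p η k) ↔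
      w ∈ ccwCone (p i : E3) (p j) (p k) := by
  simpa only [shear, shift, hi, hj, hk] using
    shear_mem_ccwCone_iff hν (s := w) (u := (p i : E3)) (v := p j) (w := p k)

/-- Between the heights `a` and `b` over `w`, the triangles spanned by the shifted vertices of the
faces leave no gap outside the shifted drawing. -/
def CoveredBetween (G : SimpleGraph (Fin n)) (p : Fin n → S2) (η : Fin n → ℝ) (w : E3)
    (a b : ℝ) : Prop :=
  ∀ x ∈ Set.Ioo a b, w + x • zAxis ∉ coneDrawing G (shift p η) → ∃ i j k, IsFace G p i j k ∧
    w + x • zAxis ∈ ccwCone (shift p η i) (shift p η j) (shift p η k)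

lemma CoveredBetween.trans {a b c : ℝ} (hab : CoveredBetween G p η w a b)
    (hbc : CoveredBetween G p η w b c) (hb : w + b • zAxis ∈ coneDrawing G (shift p η)) :
    CoveredBetween G p η w a c := by
  intro x ⟨hx, hx'⟩ hnot
  rcases lt_trichotomy x b with hxb | rfl | hxb
  · exact hab x ⟨hx, hxb⟩ hnot
  · exact absurd hb hnot
  · exact hbc x ⟨hxb, hx'⟩ hnot

lemma CoveredBetween.of_add_smul {a b r : ℝ} (h : CoveredBetween G p η (w + r • zAxis) a b) :
    CoveredBetween G p η w (r + a) (r + b) := by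
  intro x ⟨hx, hx'⟩
  have hline : w + x • zAxis = w + r • zAxis + (x - r) • zAxis := by module
  rw [hline]
  exact h _ ⟨by linarith, by linarith⟩

lemma IsPositiveShift.coveredBetween_of_consecutive (hη : IsPositiveShift G p η)
    (hp : IsGenericTriangulation G p) (hpoles : HasDistinctPolarFaces G p) (hs : 0 < s)
    (hL : LiftsBy G p η w h) (hL' : LiftsBy G p η (w + s • zAxis) h')
    (hcons : ∀ t ∈ Set.Ioo 0 s, w + t • zAxis ∉ coneDrawing G (p ·)) :
    h < s + h' ∧ CoveredBetween G p η w h (s + h') := by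
  obtain ⟨i, j, k, hf, hmem⟩ :=
    hp.exists_nonPolarFace_between hpoles hs hL.mem_coneDrawing hL'.mem_coneDrawing hcons
  obtain ⟨ν, hν, hi, hj, hk⟩ := hη.exists_shear hp hf
  have hcl (t : ℝ) (ht : t ∈ Set.Icc 0 s) :
      w + t • zAxis ∈ closure (ccwCone (p i : E3) (p j) (p k)) := by
    rw [← closure_Ioo hs.ne] at ht
    have hcont : Continuous fun t : ℝ => w + t • zAxis := by fun_prop
    have hsub : (fun t : ℝ => w + t • zAxis) '' Set.Ioo 0 s ⊆ ccwCone (p i : E3) (p j) (p k) :=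
      Set.image_subset_iff.2 hmem
    exact closure_mono hsub (image_closure_subset_closure_image hcont ⟨t, ht, rfl⟩)
  have hlift (t : ℝ) (ht : t ∈ Set.Icc 0 s) (hd : w + t • zAxis ∈ coneDrawing G (p ·)) :
      LiftsBy G p η (w + t • zAxis) (inner ℝ ν (w + t • zAxis)) := by
    refine hf.1.liftsBy_of_mem_frontier hp hi hj hk ?_
    rw [(isOpen_ccwCone _ _ _).frontier_eq]
    exact ⟨hcl t ht, fun hc => hf.1.notMem_coneDrawing hc hd⟩
  have hh : h = inner ℝ ν w := hL.unique hp (by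
    simpa using hlift 0 ⟨le_rfl, hs.le⟩ (by simpa using hL.mem_coneDrawing))
  have hh' : h' = inner ℝ ν w + s * ν 2 :=
    hL'.unique hp (inner_add_smul_zAxis ν w s ▸ hlift s ⟨hs.le, le_rfl⟩ hL'.mem_coneDrawing)
  subst hh hh'
  refine ⟨by nlinarith, fun x ⟨hx, hx'⟩ _ => ⟨i, j, k, hf.1, ?_⟩⟩
  obtain ⟨t, rfl⟩ : ∃ t, x = inner ℝ ν w + t * (1 + ν 2) :=
    ⟨(x - inner ℝ ν w) / (1 + ν 2), by field_simp; ring⟩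
  have ht : t ∈ Set.Ioo 0 s := ⟨by nlinarith, by nlinarith⟩
  have hshear : w + (inner ℝ ν w + t * (1 + ν 2)) • zAxis = shear ν (w + t • zAxis) := by
    rw [shear, inner_add_smul_zAxis]; module
  rw [hshear]
  exact (shear_mem_ccwCone_shift_iff hν hi hj hk).2 (hmem t ht)

lemma IsPositiveShift.lt_and_coveredBetween (hη : IsPositiveShift G p η)
    (hp : IsGenericTriangulation G p) (hpoles : HasDistinctPolarFaces G p) (hs : 0 < s)
    (hL : LiftsBy G p η w h) (hL' : LiftsBy G p η (w + s • zAxis) h') :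
    h < s + h' ∧ CoveredBetween G p η w h (s + h') := by
  let S : Set ℝ := {t | w + t • zAxis ∈ coneDrawing G (p ·)}
  have : Fintype S := (hp.finite_vertical_line_inter_coneDrawing w).fintype
  have : LocallyFiniteOrder S := Fintype.toLocallyFiniteOrder
  let R (a b : S) : Prop := ∀ h h', LiftsBy G p η (w + a.1 • zAxis) h →
    LiftsBy G p η (w + b.1 • zAxis) h' →
      a.1 + h < b.1 + h' ∧ CoveredBetween G p η w (a.1 + h) (b.1 + h')
  have R_of_covBy {a b : S} (hab : a ⋖ b) : R a b := by
    intro h h' hL hL'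
    have hline : w + b.1 • zAxis = w + a.1 • zAxis + (b.1 - a.1) • zAxis := by module
    obtain ⟨hlt, hcov⟩ := hη.coveredBetween_of_consecutive hp hpoles
      (sub_pos.2 (Subtype.coe_lt_coe.2 hab.lt)) hL (hline ▸ hL') fun t ht hmem => by
        refine hab.2 (c := ⟨a + t, ?_⟩) ?_ ?_
        · rwa [Set.mem_ofPred_eq, add_smul, ← add_assoc]
        · exact Subtype.mk_lt_mk.2 (lt_add_of_pos_right _ ht.1)
        · exact Subtype.mk_lt_mk.2 (by linarith [ht.2])
    exact ⟨by linarith, by simpa [← add_assoc] using hcov.of_add_smul⟩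
  have R_trans {a b c : S} (hab : R a b) (hbc : R b c) : R a c := by
    intro h h' hL hL'
    obtain ⟨hb, hLb⟩ := exists_liftsBy b.2 η
    obtain ⟨hlt, hcov⟩ := hab h hb hL hLb
    obtain ⟨hlt', hcov'⟩ := hbc hb h' hLb hL'
    exact ⟨hlt.trans hlt',
      hcov.trans hcov' (mem_coneDrawing_shift_iff.2 ⟨_, _, hLb, by module⟩)⟩
  have R_of_lt {a b : S} (hab : a < b) : R a b :=
    Relation.TransGen.trans_induction_on (transGen_covBy_of_lt hab) R_of_covBy
      fun _ _ => R_trans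
  simpa [R] using R_of_lt (a := ⟨0, by simpa [S] using hL.mem_coneDrawing⟩)
    (b := ⟨s, hL'.mem_coneDrawing⟩) (Subtype.mk_lt_mk.2 hs) h h' (by simpa using hL) hL'

lemma IsPositiveShift.exists_pos_mul (hη : IsPositiveShift G p η)
    (hp : IsGenericTriangulation G p) (hpoles : HasDistinctPolarFaces G p)
    (hL : LiftsBy G p η w h) (hL' : LiftsBy G p η (w + s • zAxis) h') :
    ∃ c > 0, s + h' - h = c * s := by
  rcases lt_trichotomy s 0 with hs | rfl | hs
  · have hlt := (hη.lt_and_coveredBetween hp hpoles (neg_pos.2 hs) hL'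
      (by simpa [add_assoc, ← add_smul] using hL)).1
    exact ⟨(s + h' - h) / s, div_pos_of_neg_of_neg (by linarith) hs,
      (div_mul_cancel₀ _ hs.ne).symm⟩
  · obtain rfl := hL.unique hp (by simpa using hL')
    exact ⟨1, one_pos, by ring⟩
  · have hlt := (hη.lt_and_coveredBetween hp hpoles hs hL hL').1
    exact ⟨(s + h' - h) / s, div_pos (by linarith) hs, (div_mul_cancel₀ _ hs.ne').symm⟩

lemma IsPositiveShift.liftsBy_injective (hη : IsPositiveShift G p η)
    (hp : IsGenericTriangulation G p) (hpoles : HasDistinctPolarFaces G p) {w' : E3}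
    (hL : LiftsBy G p η w h) (hL' : LiftsBy G p η w' h')
    (heq : w + h • zAxis = w' + h' • zAxis) : w = w' ∧ h = h' := by
  obtain rfl : w' = w + (h - h') • zAxis := by linear_combination (norm := module) -heq
  obtain ⟨c, hc, hmul⟩ := hη.exists_pos_mul hp hpoles hL hL'
  have hh : h - h' = 0 := by nlinarith
  exact ⟨by rw [hh]; simp, sub_eq_zero.1 hh⟩

lemma IsPositiveShift.notMem_coneDrawing_of_nonPolar (hη : IsPositiveShift G p η)
    (hp : IsGenericTriangulation G p) (hpoles : HasDistinctPolarFaces G p)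
    (hf : IsNonPolarFace G p i j k)
    (hv : v ∈ ccwCone (shift p η i) (shift p η j) (shift p η k)) :
    v ∉ coneDrawing G (shift p η) := by
  obtain ⟨ν, hν, hi, hj, hk⟩ := hη.exists_shear hp hf
  obtain ⟨u, rfl⟩ : ∃ u, v = shear ν u := by
    refine ⟨v + (-(inner ℝ ν v / (1 + ν 2))) • zAxis, ?_⟩
    have hcancel : -(inner ℝ ν v / (1 + ν 2)) + (inner ℝ ν v
        + -(inner ℝ ν v / (1 + ν 2)) * ν 2) = 0 := by field_simp; ring
    rw [shear, inner_add_smul_zAxis, add_assoc, ← add_smul, hcancel, zero_smul, add_zero]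
  rw [shear_mem_ccwCone_shift_iff hν hi hj hk] at hv
  rw [mem_coneDrawing_shift_iff]
  rintro ⟨w, h, hL, heq⟩
  obtain ⟨s, rfl⟩ : ∃ s : ℝ, h = inner ℝ ν u - s := ⟨inner ℝ ν u - h, by ring⟩
  obtain rfl : w = u + s • zAxis := by
    rw [shear] at heq
    linear_combination (norm := module) -heq
  obtain ⟨t, ht, hfr⟩ := exists_mem_uIcc_mem_frontier (isOpen_ccwCone _ _ _) hv fun hmem =>
    hf.1.notMem_coneDrawing hmem hL.mem_coneDrawing
  have ht0 : t ≠ 0 := by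
    rintro rfl
    rw [zero_smul, add_zero, (isOpen_ccwCone _ _ _).frontier_eq] at hfr
    exact hfr.2 hv
  have hLt := hf.1.liftsBy_of_mem_frontier hp hi hj hk hfr
  obtain ⟨c, hc, hmul⟩ := hη.exists_pos_mul hp hpoles (s := s - t) hLt (h' := inner ℝ ν u - s)
    (by rwa [add_assoc, ← add_smul, add_sub_cancel])
  rw [inner_add_smul_zAxis] at hmul
  have hts : 0 ≤ t * (s - t) := by
    rcases Set.mem_uIcc.1 ht with ⟨h0, h1⟩ | ⟨h0, h1⟩ <;> nlinarith
  have hpos : 0 < t ^ 2 * (1 + ν 2) := by positivity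
  have hkey : c * (t * (s - t)) = -(t ^ 2 * (1 + ν 2)) := by linear_combination (-t) * hmul
  linarith [mul_nonneg hc.le hts]

lemma IsPositiveShift.notMem_coneDrawing_of_winds (hη : IsPositiveShift G p η)
    (hp : IsGenericTriangulation G p) (hpoles : HasDistinctPolarFaces G p)
    (hf : IsFace G p i j k) {σ : ℝ} (hW : Winds σ (p i : E3) (p j) (p k))
    (hv : v ∈ ccwCone (shift p η i) (shift p η j) (shift p η k)) :
    v ∉ coneDrawing G (shift p η) := by
  rw [mem_coneDrawing_shift_iff]
  rintro ⟨w, h, hL, rfl⟩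
  have hD := hf.det3_ne_zero hp
  obtain ⟨r, a, b, c, habc, hwr⟩ := hW.exists_boundary hD w
  have hLb := hf.liftsBy_of_isBoundaryCoord (η := η) habc
  rw [← hwr] at hLb
  obtain ⟨d, hd, hmul⟩ := hη.exists_pos_mul hp hpoles hL hLb
  have hwmem : ¬ 0 < σ * (-r) := by
    rw [← hW.boundary_add_mem_iff hD habc, ← hwr, add_assoc, ← add_smul, add_neg_cancel,
      zero_smul, add_zero]
    exact fun hmem => hf.notMem_coneDrawing hmem hL.mem_coneDrawing
  have hvcomb : w + h • zAxis = a • shift p η i + b • shift p η j + c • shift p η k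
      + (-(d * r)) • zAxis := by
    rw [← hmul]
    simp only [shift]
    linear_combination (norm := module) hwr
  rw [hvcomb, (hW.shift η).boundary_add_mem_iff (det3_ne_zero_of_mem_ccwCone hv) habc] at hv
  nlinarith

lemma IsPositiveShift.notMem_coneDrawing (hη : IsPositiveShift G p η)
    (hp : IsGenericTriangulation G p) (hpoles : HasDistinctPolarFaces G p)
    (hf : IsFace G p i j k)
    (hv : v ∈ ccwCone (shift p η i) (shift p η j) (shift p η k)) :
    v ∉ coneDrawing G (shift p η) := by
  rcases hf.nonPolar_or_winds hp hpoles with hf' | ⟨σ, hW⟩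
  · exact hη.notMem_coneDrawing_of_nonPolar hp hpoles hf' hv
  · exact hη.notMem_coneDrawing_of_winds hp hpoles hf hW hv

end PositiveShifts

section ShiftedTriangulation

variable {n : ℕ} {G : SimpleGraph (Fin n)} {p : Fin n → S2} {η : Fin n → ℝ} {i j k : Fin n}
  {v : E3} {x : S2}

lemma IsGenericTriangulation.shift_ne_zero (hp : IsGenericTriangulation G p) (η : Fin n → ℝ)
    (i : Fin n) : shift p η i ≠ 0 := by
  have := hp.nontrivial
  obtain ⟨j, hij⟩ := exists_ne i
  exact ne_zero_of_cross_ne_zero (v := shift p η j)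
    (by rw [cross_shift]; exact hp.cross_ne_zero hij.symm)

lemma IsFace.exists_liftsBy_of_notMem (hf : IsFace G p i j k) (hp : IsGenericTriangulation G p)
    {σ : ℝ} (hW : Winds σ (p i : E3) (p j) (p k))
    (hD : det3 (shift p η i) (shift p η j) (shift p η k) ≠ 0)
    (hv : v ∉ coneDrawing G (shift p η))
    (hvf : v ∉ ccwCone (shift p η i) (shift p η j) (shift p η k)) :
    ∃ r h, LiftsBy G p η (v + r • zAxis) h ∧ 0 < σ * (r + h) := by
  obtain ⟨r, a, b, c, habc, hr⟩ := hW.exists_boundary (hf.det3_ne_zero hp) v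
  have hL := hf.liftsBy_of_isBoundaryCoord (η := η) habc
  rw [← hr] at hL
  refine ⟨r, _, hL, ?_⟩
  have hvcomb : v = a • shift p η i + b • shift p η j + c • shift p η k
      + (-(r + (a * η i + b * η j + c * η k))) • zAxis := by
    simp only [Sinking.shift]
    linear_combination (norm := module) hr
  rw [hvcomb, (hW.shift η).boundary_add_mem_iff hD habc, mul_neg, not_lt, neg_nonpos] at hvf
  refine hvf.lt_of_ne' (mul_ne_zero (fun hσ => ?_) fun hrh => hv ?_)
  · simp [Winds, hσ] at hW
  · exact mem_coneDrawing_shift_iff.2 ⟨_, _, hL, by rw [add_assoc, ← add_smul, hrh]; simp⟩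

lemma IsPositiveShift.exists_face (hη : IsPositiveShift G p η)
    (hp : IsGenericTriangulation G p) (hpoles : HasDistinctPolarFaces G p)
    (hD : ∀ i j k, IsFace G p i j k → det3 (shift p η i) (shift p η j) (shift p η k) ≠ 0)
    (hv : v ∉ coneDrawing G (shift p η)) : ∃ i j k, IsFace G p i j k ∧
      v ∈ ccwCone (shift p η i) (shift p η j) (shift p η k) := by
  by_contra! hnot
  obtain ⟨i, j, k, hN⟩ := hp.exists_northFace
  obtain ⟨i', j', k', hS⟩ := hp.exists_southFace
  obtain ⟨r, h, hL, hpos⟩ := hN.1.exists_liftsBy_of_notMem hp (hN.winds hp hpoles)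
    (hD i j k hN.1) hv (hnot i j k hN.1)
  obtain ⟨r', h', hL', hneg⟩ := hS.1.exists_liftsBy_of_notMem hp (hS.winds hp hpoles)
    (hD i' j' k' hS.1) hv (hnot i' j' k' hS.1)
  have hrr : v + r • zAxis = v + r' • zAxis + (r - r') • zAxis := by module
  rw [hrr] at hL
  obtain ⟨c, hc, hmul⟩ := hη.exists_pos_mul hp hpoles hL' hL
  have hlt : 0 < r - r' := pos_of_mul_pos_right (by linarith : 0 < c * (r - r')) hc.le
  obtain ⟨a, b, c, hf, hmem⟩ := (hη.lt_and_coveredBetween hp hpoles hlt hL' hL).2.of_add_smul 0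
    ⟨by linarith, by linarith⟩ (by simpa using hv)
  exact hnot a b c hf (by simpa using hmem)

lemma exists_liftsBy_of_mem_arc (hp : IsGenericTriangulation G p) (hij : G.Adj i j ∨ i = j)
    (hx : x ∈ arc (toSphere (shift p η i)) (toSphere (shift p η j))) :
    ∃ w h, LiftsBy G p η w h ∧ w ≠ 0 ∧ toSphere w ∈ arc (p i) (p j) ∧
      (x : E3) = w + h • zAxis := by
  obtain ⟨a, b, ha, hb, hxw⟩ :=
    (mem_arc_toSphere_iff (hp.shift_ne_zero η i) (hp.shift_ne_zero η j)).1 hx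
  rw [comb_shift] at hxw
  have hL : LiftsBy G p η (a • (p i : E3) + b • (p j : E3)) (a * η i + b * η j) :=
    ⟨i, j, hij, a, b, ha, hb, rfl, rfl⟩
  have hw : a • (p i : E3) + b • (p j : E3) ≠ 0 := fun h0 => coe_ne_zero x (by
    have hh := hL.unique hp (h' := 0) (by
      simpa only [zero_smul, zero_mul, h0] using liftsBy_vertex (G := G) (p := p) le_rfl i)
    rw [hxw, h0, hh, zero_smul, add_zero])
  exact ⟨_, _, hL, hw, toSphere_mem_arc ha hb hw, hxw⟩

lemma IsPositiveShift.exists_mem_arc_inter (hη : IsPositiveShift G p η)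
    (hp : IsGenericTriangulation G p) (hpoles : HasDistinctPolarFaces G p) {l : Fin n}
    (hij : G.Adj i j ∨ i = j) (hkl : G.Adj k l ∨ k = l)
    (hx : x ∈ arc (toSphere (shift p η i)) (toSphere (shift p η j)))
    (hx' : x ∈ arc (toSphere (shift p η k)) (toSphere (shift p η l))) :
    ∃ y ∈ arc (p i) (p j) ∩ arc (p k) (p l),
      ∀ m, y = p m → x = toSphere (shift p η m) := by
  obtain ⟨w, h, hL, hw, hmem, hxw⟩ := exists_liftsBy_of_mem_arc hp hij hx
  obtain ⟨w', h', hL', -, hmem', hxw'⟩ := exists_liftsBy_of_mem_arc hp hkl hx'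
  obtain ⟨rfl, rfl⟩ := hη.liftsBy_injective hp hpoles hL hL' (hxw.symm.trans hxw')
  refine ⟨_, ⟨hmem, hmem'⟩, fun m hm => ?_⟩
  have hwm : w = ‖w‖ • (p m : E3) := by rw [← hm, norm_smul_toSphere hw]
  have hh : h = ‖w‖ * η m := hL.unique hp (by
    rw [hwm]; simpa [norm_smul] using liftsBy_vertex (norm_nonneg w) m)
  have hxm : (x : E3) = ‖w‖ • shift p η m := by
    rw [hxw, hh, shift, smul_add, mul_smul, ← hwm]
  rw [← toSphere_coe x, hxm, toSphere_smul (norm_pos_iff.2 hw) (hp.shift_ne_zero η m)]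

lemma IsPositiveShift.embedding (hη : IsPositiveShift G p η) (hp : IsGenericTriangulation G p)
    (hpoles : HasDistinctPolarFaces G p) :
    IsShortestPathEmbedding G fun i => toSphere (shift p η i) where
  injective i j hij := by
    by_contra hne
    exact toSphere_ne_of_cross_ne_zero (by rw [cross_shift]; exact hp.cross_ne_zero hne)
      (hp.shift_ne_zero η j) hij
  length_lt i j hij := by
    have hi := hp.shift_ne_zero η i
    have hj := hp.shift_ne_zero η j
    rw [coe_toSphere hi, coe_toSphere hj,
      InnerProductGeometry.angle_smul_left_of_pos _ _ (by positivity),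
      InnerProductGeometry.angle_smul_right_of_pos _ _ (by positivity)]
    exact angle_lt_pi_of_cross_ne_zero (by rw [cross_shift]; exact hp.cross_ne_zero hij.ne)
  vertex_edge i j k hij hk := by
    obtain ⟨y, ⟨hy, hy'⟩, -⟩ := hη.exists_mem_arc_inter hp hpoles (Or.inl hij)
      (Or.inr (rfl : k = k)) hk (mem_arc_self_iff.2 rfl)
    exact hp.embedding.vertex_edge i j k hij (mem_arc_self_iff.1 hy' ▸ hy)
  edge_edge i j k l hij hkl hne x hx hx' := by
    obtain ⟨y, ⟨hy, hy'⟩, hvertex⟩ :=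
      hη.exists_mem_arc_inter hp hpoles (Or.inl hij) (Or.inl hkl) hx hx'
    obtain ⟨m, hm, hm', rfl⟩ := hp.embedding.edge_edge i j k l hij hkl hne y hy hy'
    exact ⟨m, hm, hm', hvertex m rfl⟩

lemma mem_drawing_of_mem_frontier (hij : G.Adj i j) (hjk : G.Adj j k) (hki : G.Adj k i)
    (hD : det3 (p i : E3) (p j) (p k) ≠ 0) (hx : x ∈ frontier (ccwRegion (p i) (p j) (p k))) :
    x ∈ drawing G p := by
  obtain ⟨a, b, c, ⟨⟨ha, hb, hc⟩, rfl | rfl | rfl⟩, hxw⟩ :=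
    exists_isBoundaryCoord_of_mem_frontier_ccwRegion hD hx
  · exact Or.inr ⟨j, k, hjk, b, c, hb, hc, by simpa using hxw⟩
  · exact Or.inr ⟨k, i, hki, c, a, hc, ha, by simpa [add_comm] using hxw⟩
  · exact Or.inr ⟨i, j, hij, a, b, ha, hb, by simpa using hxw⟩

lemma IsPositiveShift.isPreconnected_ccwCone (hη : IsPositiveShift G p η)
    (hp : IsGenericTriangulation G p) (hpoles : HasDistinctPolarFaces G p)
    (hf : IsFace G p i j k) (hD : det3 (shift p η i) (shift p η j) (shift p η k) ≠ 0) :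
    IsPreconnected (ccwCone (shift p η i) (shift p η j) (shift p η k)) := by
  rcases hD.lt_or_gt with hneg | hpos
  · obtain ⟨σ, hW⟩ := (hf.nonPolar_or_winds hp hpoles).resolve_left fun hf' =>
      (hη i j k hf').not_gt hneg
    exact (hW.shift η).isPreconnected_ccwCone_of_neg hneg
  · exact isPreconnected_ccwCone_of_pos hpos

lemma IsPositiveShift.exists_connectedComponentIn_eq (hη : IsPositiveShift G p η)
    (hp : IsGenericTriangulation G p) (hpoles : HasDistinctPolarFaces G p)
    (hD : ∀ i j k, IsFace G p i j k → det3 (shift p η i) (shift p η j) (shift p η k) ≠ 0)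
    (hx : x ∉ drawing G fun i => toSphere (shift p η i)) :
    ∃ i j k, IsFace G p i j k ∧
      connectedComponentIn (drawing G fun i => toSphere (shift p η i))ᶜ x =
        ccwRegion (toSphere (shift p η i)) (toSphere (shift p η j)) (toSphere (shift p η k)) := by
  have h0 := hp.shift_ne_zero η
  rw [mem_drawing_toSphere_iff h0] at hx
  obtain ⟨i, j, k, hf, hmem⟩ := hη.exists_face hp hpoles hD hx
  have hpre := hη.isPreconnected_ccwCone hp hpoles hf (hD i j k hf)
  rw [← ccwCone_toSphere (h0 i) (h0 j) (h0 k)] at hpre hmem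
  refine ⟨i, j, k, hf, connectedComponentIn_eq_of_frontier_disjoint
    (isPreconnected_ccwRegion hpre) (isOpen_ccwRegion _ _ _) (fun y hy => ?_) ?_
    (mem_ccwRegion.2 hmem)⟩
  · rw [mem_ccwRegion, ccwCone_toSphere (h0 i) (h0 j) (h0 k)] at hy
    rw [Set.mem_compl_iff, mem_drawing_toSphere_iff h0]
    exact hη.notMem_coneDrawing hp hpoles hf hy
  · exact Set.disjoint_compl_right_iff_subset.2 fun y hy =>
      mem_drawing_of_mem_frontier (p := fun i => toSphere (shift p η i)) hf.1 hf.2.1 hf.2.2.1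
        (det3_ne_zero_of_mem_ccwCone hmem) hy

lemma toSphere_mem_greatCircle_iff {ν : E3} (hv : v ≠ 0) :
    toSphere v ∈ greatCircle ν ↔ inner ℝ ν v = 0 := by
  simp [greatCircle, coe_toSphere hv, inner_smul_right, hv]

lemma IsPositiveShift.isGenericTriangulation (hη : IsPositiveShift G p η)
    (hp : IsGenericTriangulation G p) (hpoles : HasDistinctPolarFaces G p)
    (hD : ∀ i j k, i ≠ j → j ≠ k → k ≠ i →
      det3 (shift p η i) (shift p η j) (shift p η k) ≠ 0) :
    IsGenericTriangulation G fun i => toSphere (shift p η i) where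
  embedding := hη.embedding hp hpoles
  generic ν hν := by
    by_contra! hcard
    obtain ⟨i, hi, j, hj, k, hk, hij, hik, hjk⟩ := (Set.two_lt_ncard (Set.toFinite _)).1 hcard
    simp only [Set.mem_ofPred_eq, toSphere_mem_greatCircle_iff (hp.shift_ne_zero η _)] at hi hj hk
    exact hD i j k hij hjk hik.symm (det3_eq_zero_iff.2 ⟨ν, hν, hi, hj, hk⟩)
  generic_pole ν hν hN _ := by
    by_contra! hcard
    obtain ⟨i, hi, j, hj, hij⟩ := (Set.one_lt_ncard (Set.toFinite _)).1 hcard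
    simp only [Set.mem_ofPred_eq, toSphere_mem_greatCircle_iff (hp.shift_ne_zero η _)] at hi hj
    have hdet : det3 (shift p η i) (shift p η j) ((1 : ℝ) • zAxis) = 0 :=
      det3_eq_zero_iff.2 ⟨ν, hν, hi, hj, by rw [one_smul]; exact hN⟩
    rw [det3_smul_zAxis_thd, one_mul, cross_shift] at hdet
    exact hp.cross_ne_zero hij hdet
  triangular := by
    rintro F ⟨x, hx, rfl⟩
    obtain ⟨i, j, k, hf, heq⟩ := hη.exists_connectedComponentIn_eq hp hpoles
      (fun i j k hf => hD i j k hf.1.ne hf.2.1.ne hf.2.2.1.ne) hx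
    exact ⟨i, j, k, hf.1, hf.2.1, hf.2.2.1, heq⟩

end ShiftedTriangulation

section Longitudes

variable {n : ℕ} {G : SimpleGraph (Fin n)} {p q : Fin n → S2}

lemma SameLongitude.exists_eq_toSphere {x y : S2} (h : SameLongitude x y) :
    ∃ r : ℝ, y = toSphere ((x : E3) + r • zAxis) := by
  obtain ⟨θ, ⟨r, hr, hx0, hx1⟩, s, hs, hy0, hy1⟩ := h
  refine ⟨r / s * (y : E3) 2 - (x : E3) 2, ?_⟩
  have hxy : (x : E3) + (r / s * (y : E3) 2 - (x : E3) 2) • zAxis = (r / s) • (y : E3) := by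
    apply ext3
    · simp [hx0, hy0]; field_simp
    · simp [hx1, hy1]; field_simp
    · simp
  rw [hxy, toSphere_smul_coe y (by positivity)]

lemma sameLongitude_toSphere {x : S2} {v : E3} {r : ℝ} (hcross : cross (x : E3) v ≠ 0)
    (h0 : (x : E3) + r • zAxis ≠ 0) : SameLongitude x (toSphere ((x : E3) + r • zAxis)) := by
  set ζ : ℂ := ⟨(x : E3) 0, (x : E3) 1⟩ with hζ
  have hζ0 : ζ ≠ 0 := by
    intro h
    rw [hζ, Complex.ext_iff] at h
    exact hcross (by simp [cross, show (x : E3) 0 = 0 from h.1, show (x : E3) 1 = 0 from h.2])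
  have hcos : (x : E3) 0 = ‖ζ‖ * Real.cos ζ.arg := (Complex.norm_mul_cos_arg ζ).symm
  have hsin : (x : E3) 1 = ‖ζ‖ * Real.sin ζ.arg := (Complex.norm_mul_sin_arg ζ).symm
  refine ⟨ζ.arg, ⟨‖ζ‖, norm_pos_iff.2 hζ0, hcos, hsin⟩,
    ‖(x : E3) + r • zAxis‖⁻¹ * ‖ζ‖, by positivity, ?_, ?_⟩
  · rw [coe_toSphere h0, mul_assoc, ← hcos]; simp
  · rw [coe_toSphere h0, mul_assoc, ← hsin]; simp

lemma exists_eq_toSphere_shift (hl : ∀ i, SameLongitude (p i) (q i)) :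
    ∃ η : Fin n → ℝ, q = fun i => toSphere (shift p η i) := by
  choose η hη using fun i => (hl i).exists_eq_toSphere
  exact ⟨η, funext hη⟩

lemma IsGenericTriangulation.sameLongitude_toSphere_shift (hp : IsGenericTriangulation G p)
    (η : Fin n → ℝ) (i : Fin n) : SameLongitude (p i) (toSphere (shift p η i)) := by
  have := hp.nontrivial
  obtain ⟨j, hij⟩ := exists_ne i
  exact sameLongitude_toSphere (hp.cross_ne_zero hij.symm) (hp.shift_ne_zero η i)

end Longitudes

section Degeneration

variable {n : ℕ} {G : SimpleGraph (Fin n)} {p q : Fin n → S2} {i j k : Fin n}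

lemma det3_toSphere {u v w : E3} (hu : u ≠ 0) (hv : v ≠ 0) (hw : w ≠ 0) :
    det3 (toSphere u : E3) (toSphere v) (toSphere w) =
      ‖u‖⁻¹ * ‖v‖⁻¹ * ‖w‖⁻¹ * det3 u v w := by
  rw [coe_toSphere hu, coe_toSphere hv, coe_toSphere hw, det3_smul_smul_smul]

lemma IsNonPolarFace.not_winds (hf : IsNonPolarFace G p i j k) (hp : IsGenericTriangulation G p)
    {σ : ℝ} (hσ : σ = 1 ∨ σ = -1) : ¬ Winds σ (p i : E3) (p j) (p k) := by
  rintro ⟨hij, hjk, hki⟩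
  have hmem : σ • zAxis ∈ ccwCone (p i : E3) (p j) (p k) :=
    smul_zAxis_mem_ccwCone_iff.2 (Or.inl ⟨hf.det3_pos hp, hjk, hki, hij⟩)
  rcases hσ with rfl | rfl
  · exact hf.2.1 (isNorthFace_iff.2 ⟨hf.1, hmem⟩)
  · exact hf.2.2 (isSouthFace_iff.2 ⟨hf.1, hmem⟩)

lemma IsNonPolarFace.det3_ne_zero_of_sameLongitude (hf : IsNonPolarFace G p i j k)
    (hp : IsGenericTriangulation G p) (hq : IsShortestPathEmbedding G q)
    (hl : ∀ i, SameLongitude (p i) (q i)) : det3 (q i : E3) (q j) (q k) ≠ 0 := by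
  obtain ⟨η, rfl⟩ := exists_eq_toSphere_shift hl
  have h0 := hp.shift_ne_zero η
  obtain ⟨hij, hjk, hki, -⟩ := hf.1
  have hcross {a b : Fin n} (hab : G.Adj a b) : cross (shift p η a) (shift p η b) ≠ 0 := by
    rw [cross_shift]
    exact hp.cross_ne_zero hab.ne
  have off_edge {a b c : Fin n} (hab : G.Adj a b) (hbc : G.Adj b c) (hca : G.Adj c a) :
      ¬ ∃ x y : ℝ, 0 ≤ x ∧ 0 ≤ y ∧ shift p η a = x • shift p η b + y • shift p η c := by
    rintro ⟨x, y, hx, hy, heq⟩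
    have harc : toSphere (shift p η a) ∈ arc (toSphere (shift p η b)) (toSphere (shift p η c)) := by
      refine (mem_arc_toSphere_iff (h0 b) (h0 c)).2
        ⟨‖shift p η a‖⁻¹ * x, ‖shift p η a‖⁻¹ * y, by positivity, by positivity, ?_⟩
      rw [coe_toSphere (h0 a), mul_smul, mul_smul, ← smul_add, ← heq]
    exact (hq.vertex_edge b c a hbc harc).elim hab.ne hca.ne'
  rw [det3_toSphere (h0 i) (h0 j) (h0 k)]
  intro hzero
  have hD : det3 (shift p η i) (shift p η j) (shift p η k) = 0 := by simpa [h0] using hzero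
  rcases winds_of_det3_eq_zero hD (hcross hij) (hcross hjk) (hcross hki) (off_edge hij hjk hki)
    (off_edge hjk hki hij) (off_edge hki hij hjk) with hW | hW
  · exact hf.not_winds hp (Or.inl rfl) (by simpa only [Winds, cross_shift] using hW)
  · exact hf.not_winds hp (Or.inr rfl) (by simpa only [Winds, cross_shift] using hW)

lemma IsLongitudinalMorph.det3_pos {H : unitInterval → Fin n → S2}
    (hH : IsLongitudinalMorph G p q H) (hp : IsGenericTriangulation G p)
    (hf : IsNonPolarFace G p i j k) : 0 < det3 (q i : E3) (q j) (q k) := by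
  have hcont : Continuous fun t => det3 (H t i : E3) (H t j) (H t k) := by
    have hcoe (m : Fin n) : Continuous fun t => (H t m : E3) :=
      continuous_subtype_val.comp (hH.continuous m)
    have := hcoe i
    have := hcoe j
    have := hcoe k
    simp only [det3_eq]
    fun_prop
  by_contra! hle
  obtain ⟨t, ht⟩ := mem_range_of_exists_le_of_exists_ge (c := 0) hcont
    ⟨1, by rwa [hH.target]⟩ ⟨0, by rw [hH.source]; exact (hf.det3_pos hp).le⟩
  exact hf.det3_ne_zero_of_sameLongitude hp (hH.embedding t) (hH.longitudinal t) ht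

end Degeneration

section SinkingShifts

variable {n : ℕ} {G : SimpleGraph (Fin n)} {p : Fin n → S2} {η : Fin n → ℝ} {i j k : Fin n}

/-- The linear program in terms of vertical displacements: `η` keeps the non-polar faces
nonnegatively oriented and takes the vertices of the north face below the equatorial plane. -/
structure IsSinkingShift (G : SimpleGraph (Fin n)) (p : Fin n → S2) (η : Fin n → ℝ) : Prop where
  nonneg : ∀ i j k, IsNonPolarFace G p i j k →
    0 ≤ det3 (shift p η i) (shift p η j) (shift p η k)
  north_neg : ∀ i j k, IsNorthFace G p i j k → shift p η i 2 < 0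

lemma shift_two (p : Fin n → S2) (η : Fin n → ℝ) (i : Fin n) :
    shift p η i 2 = (p i : E3) 2 + η i := by
  simp [shift]

lemma det3_shift_smul (t : ℝ) (i j k : Fin n) :
    det3 (shift p (t • η) i) (shift p (t • η) j) (shift p (t • η) k) =
      (1 - t) * det3 (p i : E3) (p j) (p k)
        + t * det3 (shift p η i) (shift p η j) (shift p η k) := by
  simp [det3_eq, shift]; ring

lemma IsSinkingShift.isPositiveShift_smul (hη : IsSinkingShift G p η)
    (hp : IsGenericTriangulation G p) {t : ℝ} (ht : t ∈ Set.Ico (0 : ℝ) 1) :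
    IsPositiveShift G p (t • η) := by
  intro i j k hf
  rw [det3_shift_smul]
  exact add_pos_of_pos_of_nonneg (mul_pos (sub_pos.2 ht.2) (hf.det3_pos hp))
    (mul_nonneg ht.1 (hη.nonneg i j k hf))

lemma IsNorthFace.nonneg_of_boundary (hN : IsNorthFace G p i j k)
    (hp : IsGenericTriangulation G p) (hpoles : HasDistinctPolarFaces G p) {w : E3}
    (hw : w ∈ coneDrawing G (p ·)) {a b c r : ℝ} (habc : IsBoundaryCoord a b c)
    (hr : w + r • zAxis = a • (p i : E3) + b • (p j : E3) + c • (p k : E3)) : 0 ≤ r := by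
  by_contra! hneg
  refine hN.1.notMem_coneDrawing (w := w) ?_ hw
  obtain rfl : w = a • (p i : E3) + b • (p j : E3) + c • (p k : E3) + (-r) • zAxis := by
    linear_combination (norm := module) hr
  rw [(hN.winds hp hpoles).boundary_add_mem_iff (hN.1.det3_ne_zero hp) habc]
  linarith

lemma IsSinkingShift.le_of_boundary (hη : IsSinkingShift G p η)
    (hp : IsGenericTriangulation G p) (hpoles : HasDistinctPolarFaces G p)
    (hN : IsNorthFace G p i j k) {m : Fin n} {a b c r : ℝ} (habc : IsBoundaryCoord a b c)
    (hr : (p m : E3) + r • zAxis = a • (p i : E3) + b • (p j : E3) + c • (p k : E3)) :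
    η m ≤ r + (a * η i + b * η j + c * η k) := by
  have hvertex (η : Fin n → ℝ) : LiftsBy G p η (p m) (η m) := by
    simpa using liftsBy_vertex (G := G) (p := p) (η := η) zero_le_one m
  have hr0 := hN.nonneg_of_boundary hp hpoles (hvertex η).mem_coneDrawing habc hr
  have hle : Set.Ico (0 : ℝ) 1 ⊆ {t | t * η m ≤ r + t * (a * η i + b * η j + c * η k)} := by
    intro t ht
    have hL := hN.1.liftsBy_of_isBoundaryCoord (η := t • η) habc
    rw [← hr] at hL
    obtain ⟨d, hd, hmul⟩ :=
      (hη.isPositiveShift_smul hp ht).exists_pos_mul hp hpoles (hvertex (t • η)) hL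
    simp only [Pi.smul_apply, smul_eq_mul] at hmul
    have := mul_nonneg hd.le hr0
    rw [Set.mem_ofPred_eq]
    linarith
  have hclosed : IsClosed {t : ℝ | t * η m ≤ r + t * (a * η i + b * η j + c * η k)} :=
    isClosed_le (by fun_prop) (by fun_prop)
  have hcl := closure_minimal hle hclosed
  rw [closure_Ico zero_ne_one] at hcl
  simpa using hcl (Set.right_mem_Icc.2 zero_le_one)

lemma IsSinkingShift.neg (hη : IsSinkingShift G p η) (hp : IsGenericTriangulation G p)
    (hpoles : HasDistinctPolarFaces G p) (m : Fin n) : shift p η m 2 < 0 := by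
  obtain ⟨i, j, k, hN⟩ := hp.exists_northFace
  obtain ⟨r, a, b, c, habc, hr⟩ :=
    (hN.winds hp hpoles).exists_boundary (hN.1.det3_ne_zero hp) (p m : E3)
  have hle := hη.le_of_boundary hp hpoles hN habc hr
  have hr2 := congrArg (· 2) hr
  simp only [PiLp.add_apply, PiLp.smul_apply, smul_eq_mul, zAxis_two, mul_one] at hr2
  have hbound : shift p η m 2 ≤
      a * shift p η i 2 + b * shift p η j 2 + c * shift p η k 2 := by
    simp only [shift_two]
    linarith
  have hi := hη.north_neg i j k hN
  have hj := hη.north_neg j k i hN.rotate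
  have hk := hη.north_neg k i j hN.rotate.rotate
  obtain ⟨ha, hb, hc⟩ := habc.1
  by_contra! hm
  have hai := mul_nonpos_of_nonneg_of_nonpos ha hi.le
  have hbj := mul_nonpos_of_nonneg_of_nonpos hb hj.le
  have hck := mul_nonpos_of_nonneg_of_nonpos hc hk.le
  have ha0 : a = 0 := (mul_eq_zero.1 (by linarith : a * shift p η i 2 = 0)).resolve_right hi.ne
  have hb0 : b = 0 := (mul_eq_zero.1 (by linarith : b * shift p η j 2 = 0)).resolve_right hj.ne
  have hc0 : c = 0 := (mul_eq_zero.1 (by linarith : c * shift p η k 2 = 0)).resolve_right hk.ne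
  have hpm : (1 : ℝ) • (p m : E3) + (0 : ℝ) • (p m : E3) = (-r) • zAxis := by
    subst ha0 hb0 hc0
    linear_combination (norm := module) hr
  exact coe_ne_zero (p m)
    (by simpa using hp.comb_eq_zero_of_eq_smul_zAxis hpm fun i => (p i : E3))

lemma eventually_affine_ne_zero {a b : ℝ} (ha : a ≠ 0) :
    ∀ᶠ t in nhdsWithin (1 : ℝ) (Set.Iio 1), (1 - t) * a + t * b ≠ 0 := by
  rcases eq_or_ne b 0 with rfl | hb
  · filter_upwards [self_mem_nhdsWithin] with t ht
    simpa [ha] using (sub_pos.2 (Set.mem_Iio.1 ht)).ne'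
  · have hcont : Continuous fun t : ℝ => (1 - t) * a + t * b := by fun_prop
    exact nhdsWithin_le_nhds (hcont.continuousAt.eventually_ne (by simpa using hb))

lemma IsSinkingShift.exists_generic_smul (hη : IsSinkingShift G p η)
    (hp : IsGenericTriangulation G p) (hpoles : HasDistinctPolarFaces G p) :
    ∃ t ∈ Set.Ioo (0 : ℝ) 1, (∀ m, shift p (t • η) m 2 < 0) ∧
      ∀ i j k, i ≠ j → j ≠ k → k ≠ i →
        det3 (shift p (t • η) i) (shift p (t • η) j) (shift p (t • η) k) ≠ 0 := by
  have hneg : ∀ᶠ t in nhdsWithin (1 : ℝ) (Set.Iio 1), ∀ m, shift p (t • η) m 2 < 0 := by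
    refine Filter.eventually_all.2 fun m => nhdsWithin_le_nhds ?_
    have hcont : Continuous fun t : ℝ => shift p (t • η) m 2 := by
      simp only [shift_two, Pi.smul_apply]
      fun_prop
    exact hcont.continuousAt.eventually_lt_const (by simpa using hη.neg hp hpoles m)
  have hgen : ∀ᶠ t in nhdsWithin (1 : ℝ) (Set.Iio 1), ∀ i j k, i ≠ j → j ≠ k → k ≠ i →
      det3 (shift p (t • η) i) (shift p (t • η) j) (shift p (t • η) k) ≠ 0 := by
    simp only [Filter.eventually_all, det3_shift_smul]
    exact fun i j k hij hjk hki => eventually_affine_ne_zero (hp.det3_ne_zero hij hjk hki)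
  have hIoo : ∀ᶠ t in nhdsWithin (1 : ℝ) (Set.Iio 1), t ∈ Set.Ioo (0 : ℝ) 1 :=
    Ioo_mem_nhdsLT zero_lt_one
  exact (hIoo.and (hneg.and hgen)).exists

lemma isLongitudinalMorph_shift (hp : IsGenericTriangulation G p)
    (hpoles : HasDistinctPolarFaces G p)
    (hη : ∀ t ∈ Set.Icc (0 : ℝ) 1, IsPositiveShift G p (t • η)) :
    IsLongitudinalMorph G p (fun i => toSphere (shift p η i))
      fun t i => toSphere (shift p ((t : ℝ) • η) i) where
  continuous i := by
    refine continuousOn_toSphere.comp_continuous ?_ fun t => hp.shift_ne_zero _ i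
    simp only [shift, Pi.smul_apply, smul_eq_mul]
    fun_prop
  source := by simp [shift, toSphere_coe]
  target := by simp
  embedding t := (hη t t.2).embedding hp hpoles
  longitudinal t := hp.sameLongitude_toSphere_shift _

lemma toSphere_two_neg_iff {v : E3} (hv : v ≠ 0) : (toSphere v : E3) 2 < 0 ↔ v 2 < 0 := by
  have hpos := inv_pos.2 (norm_pos_iff.2 hv)
  rw [coe_toSphere hv, PiLp.smul_apply, smul_eq_mul, mul_neg_iff]
  simp only [hpos, hpos.not_gt, true_and, false_and, or_false]

lemma IsSinkingShift.sinkable (hη : IsSinkingShift G p η) (hp : IsGenericTriangulation G p)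
    (hpoles : HasDistinctPolarFaces G p) : Sinkable G p := by
  obtain ⟨T, ⟨hT0, hT1⟩, hneg, hgen⟩ := hη.exists_generic_smul hp hpoles
  have hpos := hη.isPositiveShift_smul hp ⟨hT0.le, hT1⟩
  refine ⟨_, hpos.isGenericTriangulation hp hpoles hgen,
    fun m => (toSphere_two_neg_iff (hp.shift_ne_zero _ m)).2 (hneg m), _,
    isLongitudinalMorph_shift hp hpoles fun t ⟨ht0, ht1⟩ => ?_⟩
  rw [smul_smul]
  exact hη.isPositiveShift_smul hp ⟨by positivity, by nlinarith⟩

lemma Sinkable.exists_isSinkingShift (hs : Sinkable G p) (hp : IsGenericTriangulation G p) :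
    ∃ η, IsSinkingShift G p η := by
  obtain ⟨q, -, hq, H, hH⟩ := hs
  obtain ⟨η, rfl⟩ := exists_eq_toSphere_shift fun i => hH.target ▸ hH.longitudinal 1 i
  have h0 := hp.shift_ne_zero η
  refine ⟨η, fun i j k hf => ?_, fun i _ _ _ => (toSphere_two_neg_iff (h0 i)).1 (hq i)⟩
  have hpos := hH.det3_pos hp hf
  rw [det3_toSphere (h0 i) (h0 j) (h0 k)] at hpos
  exact (pos_of_mul_pos_right hpos (by positivity)).le

lemma sinkable_iff (hp : IsGenericTriangulation G p) (hpoles : HasDistinctPolarFaces G p) :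
    Sinkable G p ↔ ∃ η, IsSinkingShift G p η :=
  ⟨fun hs => hs.exists_isSinkingShift hp, fun ⟨_, hη⟩ => hη.sinkable hp hpoles⟩

end SinkingShifts

section LinearProgram

variable {n : ℕ} {G : SimpleGraph (Fin n)} {p : Fin n → S2} {X : Fin n → E3}

lemma feasible_sinkLP_iff : (sinkLP G p X).Feasible ↔ ∃ z : Fin n → ℝ,
    (∀ i j k, IsNorthFace G p i j k → z i = -1) ∧
      ∀ i j k, IsNonPolarFace G p i j k → 0 ≤ vol' X i j k z := by
  simp only [LinearProgram.Feasible, sinkLP, Set.forall_mem_image, Set.mem_ofPred_eq,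
    LinearMap.proj_apply, Prod.forall, forall_exists_index]

lemma vol'_smul_shift (p : Fin n → S2) (r η : Fin n → ℝ) (i j k : Fin n) :
    vol' (fun m => r m • (p m : E3)) i j k (fun m => r m * shift p η m 2) =
      r i * r j * r k * det3 (shift p η i) (shift p η j) (shift p η k) := by
  simp [vol', Matrix.det_fin_three, det3_eq, shift]; ring

lemma feasible_sinkLP_iff_exists_shift {r : Fin n → ℝ} (hr : ∀ m, 0 < r m) :
    (sinkLP G p fun m => r m • (p m : E3)).Feasible ↔ ∃ η : Fin n → ℝ,
      (∀ i j k, IsNorthFace G p i j k → r i * shift p η i 2 = -1) ∧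
        ∀ i j k, IsNonPolarFace G p i j k →
          0 ≤ det3 (shift p η i) (shift p η j) (shift p η k) := by
  have hsurj : Function.Surjective fun (η : Fin n → ℝ) m => r m * shift p η m 2 := by
    refine fun z => ⟨fun m => z m / r m - (p m : E3) 2, funext fun m => ?_⟩
    change r m * shift p _ m 2 = z m
    rw [shift_two, add_sub_cancel, mul_div_cancel₀ _ (hr m).ne']
  rw [feasible_sinkLP_iff, hsurj.exists]
  have hrrr (i j k : Fin n) : 0 < r i * r j * r k := mul_pos (mul_pos (hr i) (hr j)) (hr k)
  simp only [vol'_smul_shift, mul_nonneg_iff_of_pos_left (hrrr _ _ _)]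

lemma Winds.exists_shear {u v w : E3} (hW : Winds 1 u v w) (hu : u 2 < 0) (hv : v 2 < 0)
    (hw : w 2 < 0) {a b c : ℝ} (ha : a < 0) (hb : b < 0) (hc : c < 0) :
    ∃ ν : E3, 0 < 1 + ν 2 ∧ shear ν u 2 = a ∧ shear ν v 2 = b ∧ shear ν w 2 = c := by
  obtain ⟨huv, hvw, hwu⟩ := hW
  rw [one_mul] at huv hvw hwu
  have hcomb := det3_smul_zAxis_eq u v w
  have hD : det3 u v w = cross v w * u 2 + cross w u * v 2 + cross u v * w 2 := by
    simpa using congrArg (· 2) hcomb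
  have hDneg : det3 u v w < 0 := by
    rw [hD]
    linarith [mul_neg_of_pos_of_neg hvw hu, mul_neg_of_pos_of_neg hwu hv,
      mul_neg_of_pos_of_neg huv hw]
  obtain ⟨ν, hνu, hνv, hνw⟩ := exists_inner_eq hDneg.ne (a - u 2) (b - v 2) (c - w 2)
  have hν : det3 u v w * (1 + ν 2) = cross v w * a + cross w u * b + cross u v * c := by
    have hinner := congrArg (inner ℝ ν) hcomb
    simp only [inner_add_right, inner_smul_right, hνu, hνv, hνw] at hinner
    have hz : inner ℝ ν zAxis = ν 2 := by simp [inner_eq]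
    rw [hz] at hinner
    linear_combination hinner + hD
  have hν_neg : det3 u v w * (1 + ν 2) < 0 := by
    rw [hν]
    linarith [mul_neg_of_pos_of_neg hvw ha, mul_neg_of_pos_of_neg hwu hb,
      mul_neg_of_pos_of_neg huv hc]
  refine ⟨ν, pos_of_mul_neg_right hν_neg hDneg.le, ?_, ?_, ?_⟩ <;> simp [shear, *]

lemma shear_shift (ν : E3) (p : Fin n → S2) (η : Fin n → ℝ) (i : Fin n) :
    shear ν (shift p η i) = shift p (fun m => η m + inner ℝ ν (shift p η m)) i := by
  simp only [shear, shift]; module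

lemma feasible_sinkLP_iff_exists_isSinkingShift (hp : IsGenericTriangulation G p)
    (hpoles : HasDistinctPolarFaces G p) (hX : IsHomogeneousCoordinates p X) :
    (sinkLP G p X).Feasible ↔ ∃ η, IsSinkingShift G p η := by
  choose r hr hXr using hX
  obtain rfl : X = fun m => r m • (p m : E3) := funext hXr
  rw [feasible_sinkLP_iff_exists_shift hr]
  constructor
  · rintro ⟨η, hN, hη⟩
    refine ⟨η, hη, fun i j k hf => ?_⟩
    exact neg_of_mul_neg_right (by rw [hN i j k hf]; exact neg_one_lt_zero) (hr i).le
  · rintro ⟨η, hη, hneg⟩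
    obtain ⟨i, j, k, hN⟩ := hp.exists_northFace
    have hr' (m : Fin n) : -(r m)⁻¹ < 0 := neg_neg_of_pos (inv_pos.2 (hr m))
    obtain ⟨ν, hν, hi, hj, hk⟩ := ((hN.winds hp hpoles).shift η).exists_shear
      (hneg i j k hN) (hneg j k i hN.rotate) (hneg k i j hN.rotate.rotate)
      (hr' i) (hr' j) (hr' k)
    refine ⟨fun m => η m + inner ℝ ν (shift p η m), fun i' j' k' hN' => ?_, fun a b c hf => ?_⟩
    · rw [← shear_shift]
      rcases hN.vertex_eq hN' hp with rfl | rfl | rfl <;>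
        simp only [hi, hj, hk, mul_neg, mul_inv_cancel₀ (hr _).ne']
    · simp only [← shear_shift, det3_shear]
      exact mul_nonneg hν.le (hη a b c hf)

end LinearProgram

end Sinking

end

theorem lemmaL {n : ℕ} (hn : 4 ≤ n) (G : SimpleGraph (Fin n))
    (p : Fin n → Sinking.S2) (hp : Sinking.IsGenericTriangulation G p)
    (hpoles : ∀ i j k, ¬ (Sinking.IsNorthFace G p i j k ∧ Sinking.IsSouthFace G p i j k))
    (X : Fin n → Sinking.E3) (hX : Sinking.IsHomogeneousCoordinates p X) :
    Sinking.Sinkable G p ↔ (Sinking.sinkLP G p X).Feasible :=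
  (Sinking.sinkable_iff hp hpoles).trans
    (Sinking.feasible_sinkLP_iff_exists_isSinkingShift hp hpoles hX).symm
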